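/- **The algebra $\mathcal{T}_d$.** For $d\ge 0$ let $\mathcal{Q}_d$ be the hypercube graph, with vertex set $X=\{-1,1\}^d$, two vertices being adjacent when they differ in exactly one coordinate; it is distance-regular with diameter $d$. Let $\partial$ denote path-length distance. - For $0\le h,i,j\le d$ let $p^h_{ij}$ be the intersection numbers: $p^h_{ij}=|\{z\in X:\partial(x,z)=i,\ \partial(y,z)=j\}|$ for any $x,y\in X$ with $\partial(x,y)=h$. - Let $A_i$ be the $i$th distance matrix, with $(A_i)_{xy}=1$ if $\partial(x,y)=i$ and $0$ otherwise. Let $\theta_0>\theta_1>\dots>\theta_d$ be the distinct eigenvalues of the adjacency matrix, and let $E_i$ be the matrix acting as the identity on the $\theta_i$-eigenspace and as $0$ on the other eigenspaces. - Define the Krein parameters $(p^h_{ij})^*$ by $E_i\circ E_j=|X|^{-1}\sum_{h=0}^d (p^h_{ij})^*E_h$, where $\circ$ is the entrywise product, and define the scalars $q_i(j)$ by $E_i=|X|^{-1}\sum_{j=0}^d q_i(j)A_j$. - For $x\in X$ let $E_i^*(x)$ and $A_i^*(x)$ be the diagonal matrices with $(y,y)$-entries $(A_i)_{xy}$ and $|X|(E_i)_{xy}$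 respectively. Define scalars $q_i^*(j)$, independent of $x$, by $E_i^*(x)=|X|^{-1}\sum_{j=0}^d q_i^*(j)A_j^*(x)$. The generalized Terwilliger algebra $\mathcal{T}_d$ of $\mathcal{Q}_d$ is the unital associative $\mathbb{C}$-algebra with generators $x_0,\dots,x_d,x_0^*,\dots,x_d^*$ and the following relations, for $0\le h,i,j\le d$: $$x_0=x_0^*=1,\qquad x_ix_j=\sum_{h=0}^d p^h_{ij}x_h,\qquad x_i^*x_j^*=\sum_{h=0}^d (p^h_{ij})^*x_h^*,$$ $$e_h^*x_ie_j^*=0\ \text{ if } p^h_{ij}=0,\qquad e_hx_i^*e_j=0\ \text{ if } (p^h_{ij})^*=0,$$ where $e_i=|X|^{-1}\sum_{j=0}^d q_i(j)x_j$ and $e_i^*=|X|^{-1}\sum_{j=0}^d q_i^*(j)x_j^*$ for $0\le i\le d$. **Corollary.** Let $d\ge 2$, and put $k_i=p^0_{ii}$ and $k_i^*=(p^0_{ii})^*$ for $0\le i\le d$. In $\mathcal{T}_d$ we have $$2^d\sum_{i=0}^d k_i^{-1}e_i^*e_0e_i^*=2^d\sum_{i=0}^d (k_i^*)^{-1}e_ie_0^*e_i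 ,$$ and this common value, denoted $u_0$, is central and idempotent; thus $\mathcal{T}_d(1-u_0)$ is an algebra with identity $1-u_0$. There exists an algebra isomorphism $\mathcal{T}_d(1-u_0)\to\mathcal{T}_{d-2}$ that sends \begin{align*} e_0(1-u_0)&\mapsto 0, & e_0^*(1-u_0)&\mapsto 0,\\ e_i(1-u_0)&\mapsto e_{i-1}, & e_i^*(1-u_0)&\mapsto e_{i-1}^*\qquad(1\le i\le d-1),\\ e_d(1-u_0)&\mapsto 0, & e_d^*(1-u_0)&\mapsto 0. \end{align*} -/

import Mathlib

noncomputable section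

/-- The coordinates of `m` with respect to the family `b 0, …, b D`: scalars `c` with
`m = ∑_{j ≤ D} c j • b j` (determined for indices `≤ D` if the family is linearly independent
and `m` lies in its span, which is the case in every use below for a distance-regular graph). -/
def coords {M : Type*} [AddCommMonoid M] [Module ℂ M] (b : ℕ → M) (D : ℕ) (m : M) : ℕ → ℂ :=
  Classical.epsilon fun c => m = ∑ j ∈ Finset.range (D + 1), c j • b j

namespace SimpleGraph

variable {V : Type*} [Fintype V] (G : SimpleGraph V)

/-- `p h i j` is the number of vertices `z` with `∂(x,z) = i`, `∂(y,z) = j`, for all vertices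
`x, y` with `∂(x,y) = h`. -/
def HasIntersectionNumbers (p : ℕ → ℕ → ℕ → ℕ) : Prop :=
  ∀ h i j, h ≤ G.diam → i ≤ G.diam → j ≤ G.diam → ∀ x y : V, G.dist x y = h →
    {z : V | G.dist x z = i ∧ G.dist y z = j}.ncard = p h i j

/-- The intersection numbers `p^h_{ij}`, for `Γ` distance-regular (that is, connected and such that
these numbers exist; they are then unique for indices up to the diameter). -/
def intersectionNumber : ℕ → ℕ → ℕ → ℕ := Classical.epsilon G.HasIntersectionNumbers

/-- The valency `k_i = p^0_{ii}`. -/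
def valency (i : ℕ) : ℕ := G.intersectionNumber 0 i i

open scoped Classical in
/-- The distance matrix `A_i`. -/
def distMatrix (i : ℕ) : Matrix V V ℂ := Matrix.of fun x y => if G.dist x y = i then 1 else 0

open scoped Classical in
/-- `θ 0 > θ 1 > ⋯ > θ d` are exactly the eigenvalues of the adjacency matrix, where `d` is the
diameter. -/
def IsEigenvalueSeq (θ : ℕ → ℝ) : Prop :=
  StrictAntiOn θ (Set.Iic G.diam) ∧
    ∀ μ : ℂ, Module.End.HasEigenvalue (Matrix.toLin' (G.adjMatrix ℂ)) μ ↔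
      ∃ i ≤ G.diam, ((θ i : ℝ) : ℂ) = μ

/-- The eigenvalues `θ_0 > θ_1 > ⋯ > θ_d` of a distance-regular graph of diameter `d`. -/
def theta : ℕ → ℝ := Classical.epsilon G.IsEigenvalueSeq

open scoped Classical in
/-- `E i` acts as the identity on the `θ_i`-eigenspace of the adjacency matrix and as `0` on the
other eigenspaces. -/
def ArePrimitiveIdempotents (E : ℕ → Matrix V V ℂ) : Prop :=
  ∀ i ≤ G.diam, ∀ j ≤ G.diam, ∀ v : V → ℂ,
    (G.adjMatrix ℂ).mulVec v = ((G.theta j : ℝ) : ℂ) • v →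
      (E i).mulVec v = if i = j then v else 0

/-- The primitive idempotents `E_0, …, E_d`. -/
def primitiveIdempotent : ℕ → Matrix V V ℂ := Classical.epsilon G.ArePrimitiveIdempotents

/-- The Krein parameters `(p^h_{ij})^*`, defined by
`|X| • (E_i ∘ E_j) = ∑_h (p^h_{ij})^* E_h`, where `∘` is the entrywise product. -/
def kreinParameter (h i j : ℕ) : ℂ :=
  coords G.primitiveIdempotent G.diam
    ((Fintype.card V : ℂ) •
      Matrix.hadamard (G.primitiveIdempotent i) (G.primitiveIdempotent j)) h

/-- The dual valency `k_i^* = (p^0_{ii})^*`. -/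
def dualValency (i : ℕ) : ℂ := G.kreinParameter 0 i i

open scoped Classical in
/-- The dual primitive idempotent `E_i^*(x)`. -/
def dualPrimitiveIdempotent (x : V) (i : ℕ) : Matrix V V ℂ :=
  Matrix.diagonal fun y => if G.dist x y = i then 1 else 0

open scoped Classical in
/-- The dual distance matrix `A_i^*(x)`. -/
def dualDistMatrix (x : V) (i : ℕ) : Matrix V V ℂ :=
  Matrix.diagonal fun y => (Fintype.card V : ℂ) * G.primitiveIdempotent i x y

/-- The scalars `q_i(j)`, defined by `E_i = |X|⁻¹ ∑_j q_i(j) A_j`. -/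
def qCoeff (i j : ℕ) : ℂ :=
  coords G.distMatrix G.diam ((Fintype.card V : ℂ) • G.primitiveIdempotent i) j

/-- The scalars `q_i^*(j)`, defined by `E_i^*(x) = |X|⁻¹ ∑_j q_i^*(j) A_j^*(x)`
(simultaneously for all vertices `x`; these scalars do not depend on `x`). -/
def dualQCoeff (i j : ℕ) : ℂ :=
  coords (fun j x => G.dualDistMatrix x j) G.diam
    ((Fintype.card V : ℂ) • fun x => G.dualPrimitiveIdempotent x i) j

/-- The free algebra on symbols `x_0, …, x_d` (left summand) and `x_0^*, …, x_d^*` (right summand),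
where `d` is the diameter. -/
abbrev TerwilligerFree : Type := FreeAlgebra ℂ (Fin (G.diam + 1) ⊕ Fin (G.diam + 1))

/-- The free generator `x_i`; zero if `i > d`. -/
def freeX (i : ℕ) : G.TerwilligerFree :=
  if hi : i < G.diam + 1 then FreeAlgebra.ι ℂ (Sum.inl ⟨i, hi⟩) else 0

/-- The free generator `x_i^*`; zero if `i > d`. -/
def freeXs (i : ℕ) : G.TerwilligerFree :=
  if hi : i < G.diam + 1 then FreeAlgebra.ι ℂ (Sum.inr ⟨i, hi⟩) else 0

/-- `e_i = |X|⁻¹ ∑_j q_i(j) x_j` in the free algebra; zero if `i > d`. -/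
def freeE (i : ℕ) : G.TerwilligerFree :=
  if i ≤ G.diam then
    (Fintype.card V : ℂ)⁻¹ • ∑ j ∈ Finset.range (G.diam + 1), G.qCoeff i j • G.freeX j
  else 0

/-- `e_i^* = |X|⁻¹ ∑_j q_i^*(j) x_j^*` in the free algebra; zero if `i > d`. -/
def freeEs (i : ℕ) : G.TerwilligerFree :=
  if i ≤ G.diam then
    (Fintype.card V : ℂ)⁻¹ • ∑ j ∈ Finset.range (G.diam + 1), G.dualQCoeff i j • G.freeXs j
  else 0

/-- The defining relations of the generalized Terwilliger algebra. -/
inductive TerwilligerRel : G.TerwilligerFree → G.TerwilligerFree → Prop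
  | T1 : TerwilligerRel (G.freeX 0) 1
  | T1s : TerwilligerRel (G.freeXs 0) 1
  | T2 (i j : ℕ) (hi : i ≤ G.diam) (hj : j ≤ G.diam) :
      TerwilligerRel (G.freeX i * G.freeX j)
        (∑ h ∈ Finset.range (G.diam + 1), (G.intersectionNumber h i j : ℂ) • G.freeX h)
  | T2s (i j : ℕ) (hi : i ≤ G.diam) (hj : j ≤ G.diam) :
      TerwilligerRel (G.freeXs i * G.freeXs j)
        (∑ h ∈ Finset.range (G.diam + 1), G.kreinParameter h i j • G.freeXs h)
  | T3 (h i j : ℕ) (hh : h ≤ G.diam) (hi : i ≤ G.diam) (hj : j ≤ G.diam)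
      (hp : G.intersectionNumber h i j = 0) :
      TerwilligerRel (G.freeEs h * G.freeX i * G.freeEs j) 0
  | T3s (h i j : ℕ) (hh : h ≤ G.diam) (hi : i ≤ G.diam) (hj : j ≤ G.diam)
      (hp : G.kreinParameter h i j = 0) :
      TerwilligerRel (G.freeE h * G.freeXs i * G.freeE j) 0

/-- The generalized Terwilliger algebra of `Γ`. -/
abbrev GenTerwilliger : Type := RingQuot G.TerwilligerRel

/-- The element `e_i` of the generalized Terwilliger algebra; zero if `i > d`. -/
def genE (i : ℕ) : G.GenTerwilliger := RingQuot.mkAlgHom ℂ G.TerwilligerRel (G.freeE i)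

/-- The element `e_i^*` of the generalized Terwilliger algebra; zero if `i > d`. -/
def genEs (i : ℕ) : G.GenTerwilliger := RingQuot.mkAlgHom ℂ G.TerwilligerRel (G.freeEs i)

end SimpleGraph

/-- The hypercube `Q_d`: vertices are the `d`-tuples of signs `±1` (`ℤˣ = {1, -1}`), adjacent when
they differ in exactly one coordinate. -/
def hypercube (d : ℕ) : SimpleGraph (Fin d → ℤˣ) where
  Adj a b := ∃! i, a i ≠ b i
  symm := ⟨fun _ _ h => by simpa only [ne_comm] using h⟩
  loopless := ⟨fun _ h => by
    obtain ⟨i, hi, -⟩ := h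
    exact hi rfl⟩

/-- The generalized Terwilliger algebra `𝒯_d` of the hypercube `Q_d`. -/
abbrev CubeT (d : ℕ) : Type := (hypercube d).GenTerwilliger

/-- The element `e_i` of `𝒯_d`. -/
abbrev cubeE (d i : ℕ) : CubeT d := (hypercube d).genE i

/-- The element `e_i^*` of `𝒯_d`. -/
abbrev cubeEs (d i : ℕ) : CubeT d := (hypercube d).genEs i

/-- The element `u_0 = 2^d ∑_i k_i⁻¹ e_i^* e_0 e_i^*` of `𝒯_d`. -/
def cubeU (d : ℕ) : CubeT d :=
  (2 : ℂ) ^ d • ∑ i ∈ Finset.range (d + 1),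
    ((hypercube d).valency i : ℂ)⁻¹ • (cubeEs d i * cubeE d 0 * cubeEs d i)

/-- The element `2^d ∑_i (k_i^*)⁻¹ e_i e_0^* e_i` of `𝒯_d`. -/
def cubeUDual (d : ℕ) : CubeT d :=
  (2 : ℂ) ^ d • ∑ i ∈ Finset.range (d + 1),
    ((hypercube d).dualValency i)⁻¹ • (cubeE d i * cubeEs d 0 * cubeE d i)

/-- The set `A c = {a c : a ∈ A}`, as a (not necessarily unital) subalgebra of `A`. If `c` is a
central idempotent, this is a two-sided ideal, and an algebra with identity `c`. -/
def mulRightSubalgebra {A : Type*} [Ring A] [Algebra ℂ A] (c : A) : NonUnitalSubalgebra ℂ A where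
  carrier := Set.range fun a => a * c
  add_mem' := by
    rintro _ _ ⟨a, rfl⟩ ⟨b, rfl⟩
    exact ⟨a + b, add_mul a b c⟩
  zero_mem' := ⟨0, zero_mul c⟩
  mul_mem' := by
    rintro _ _ ⟨a, rfl⟩ ⟨b, rfl⟩
    exact ⟨a * c * b, mul_assoc (a * c) b c⟩
  smul_mem' := by
    rintro r _ ⟨a, rfl⟩
    exact ⟨r • a, smul_mul_assoc r a c⟩

/-- The element `a c` of `A c`. -/
def toMulRight {A : Type*} [Ring A] [Algebra ℂ A] (c a : A) : mulRightSubalgebra c :=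
  ⟨a * c, a, rfl⟩

end

/-! Most defining relations of 𝒯_d are redundant. Beyond the fact that `e` and `es` are complete
systems of orthogonal idempotents, only the triple product relations with middle index 1 are needed:
`krawSum d e 1` and `krawSum d es 1`, with eigenvalues `d - 2i` on their own idempotents, each act
on the other system tridiagonally with zero diagonal. Krawtchouk recurrences then force every other
vanishing triple product (`IsCubePair.triple_eq_zero`), so 𝒯_d is the universal algebra carrying an
`IsCubePair` of diameter `d` (`isCubePair_cubeT`, `IsCubePair.exists_algHom`).

In this form the passage between diameters is a shift of indices. Because `(n + 2) - 2(i + 1) = n -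
2i`, a pair of diameter `n` padded by zeros at both ends is a pair of diameter `n + 2`, and a pair
of diameter `n + 2` whose four end idempotents vanish is a pair of diameter `n`. Padding gives a
surjection 𝒯_{n+2} → 𝒯_n that kills u_0. Conversely u_0 is a central idempotent fixing the four end
idempotents, so these vanish modulo u_0, and the quotient receives a map from 𝒯_n. The two maps
compose to the quotient map, so the kernel of the surjection is exactly 𝒯_{n+2} u_0
(`exists_reduction`).

That the two formulas for u_0 agree follows by computing their product in two ways
(`IsCubePair.primaryIdem_dual`); centrality and idempotence are consequences. The graph enters only
through closed forms, which exhibit the self-duality of the cube: intersection numbers and Krein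
parameters are both `cubeP`, and both families of coefficients q and q* are `kraw`. -/

noncomputable section

open Polynomial in
/-- The Krawtchouk number `K_i(j)`: the coefficient of `t ^ i` in
`(1 - t) ^ j (1 + t) ^ (d - j)`. -/
def kraw (d i j : ℕ) : ℂ := ((1 - X) ^ j * (1 + X) ^ (d - j) : ℂ[X]).coeff i

/-- The intersection numbers of the hypercube, in closed form: `a` counts the changes inside
and `b` those outside the set of `h` coordinates in which two given vertices differ. -/
def cubeP (d h i j : ℕ) : ℕ :=
  ∑ a ∈ Finset.range (h + 1), ∑ b ∈ Finset.range (d - h + 1),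
    if a + b = i ∧ h + b = j + a then h.choose a * (d - h).choose b else 0

/-! ### Krawtchouk numbers: recurrences, orthogonality and the product rule. -/

section Krawtchouk

open Polynomial

lemma kraw_natDegree_le {d j : ℕ} (hj : j ≤ d) :
    ((1 - X) ^ j * (1 + X) ^ (d - j) : ℂ[X]).natDegree ≤ d := by
  have h1 : ((1 - X : ℂ[X])).natDegree ≤ 1 := by compute_degree
  have h2 : ((1 + X : ℂ[X])).natDegree ≤ 1 := by compute_degree
  refine natDegree_mul_le.trans ?_
  have := natDegree_pow_le_of_le j h1
  have := natDegree_pow_le_of_le (d - j) h2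
  omega

lemma kraw_eq_zero {d i j : ℕ} (hj : j ≤ d) (hi : d < i) : kraw d i j = 0 :=
  coeff_eq_zero_of_natDegree_lt ((kraw_natDegree_le hj).trans_lt hi)

lemma kraw_zero_left (d j : ℕ) : kraw d 0 j = 1 := by
  simp [kraw, coeff_zero_eq_eval_zero]

lemma kraw_zero_right (d i : ℕ) : kraw d i 0 = d.choose i := by
  simp [kraw, coeff_one_add_X_pow]

lemma kraw_one {d j : ℕ} (hj : j ≤ d) : kraw d 1 j = d - 2 * j := by
  have h (n : ℕ) : ((1 - X : ℂ[X]) ^ n).coeff 1 = -n := by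
    induction n with
    | zero => simp [coeff_one]
    | succ n ih =>
      rw [pow_succ, mul_coeff_one, ih]
      simp [coeff_zero_eq_eval_zero, coeff_one]
  rw [kraw, mul_coeff_one, h, coeff_one_add_X_pow]
  simp [coeff_zero_eq_eval_zero, hj]
  ring

lemma kraw_top_mul_self {d j : ℕ} (hj : j ≤ d) : kraw d d j * kraw d d j = 1 := by
  have h1 : ((1 - X : ℂ[X])).natDegree ≤ 1 := by compute_degree
  have h2 : ((1 + X : ℂ[X])).natDegree ≤ 1 := by compute_degree
  have h : kraw d d j = (-1) ^ j := by
    have h3 := coeff_mul_add_eq_of_natDegree_le (natDegree_pow_le_of_le j h1)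
      (natDegree_pow_le_of_le (d - j) h2)
    rw [coeff_pow_of_natDegree_le h1, coeff_pow_of_natDegree_le h2] at h3
    rw [kraw]
    convert h3 using 2
    · omega
    · simp [coeff_one]
  rw [h, ← mul_pow]
  simp

/-- The generating functions for `j` and `j + 1` have difference `2X g` and sum `2 g`, where `g` is
their common factor. -/
lemma kraw_sub_kraw_succ {d i j : ℕ} (hj : j < d) :
    kraw d (i + 1) j - kraw d (i + 1) (j + 1) = kraw d i j + kraw d i (j + 1) := by
  have h : ((1 - X) ^ j * (1 + X) ^ (d - j) - (1 - X) ^ (j + 1) * (1 + X) ^ (d - (j + 1)) : ℂ[X]) =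
      ((1 - X) ^ j * (1 + X) ^ (d - j) + (1 - X) ^ (j + 1) * (1 + X) ^ (d - (j + 1))) * X := by
    obtain ⟨m, rfl⟩ := Nat.exists_eq_add_of_lt hj
    rw [show j + m + 1 - j = m + 1 by omega, show j + m + 1 - (j + 1) = m by omega]
    ring
  have h' := congrArg (fun p => p.coeff (i + 1)) h
  simp only [coeff_sub, coeff_mul_X, coeff_add] at h'
  exact h'

/-- Logarithmic differentiation of `f = (1 - X)^j (1 + X)^(d - j)` gives `(1 - X²) f' = (d - 2j -
dX) f`; this is its coefficient of degree `i + 1`. -/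
lemma kraw_recurrence {d i j : ℕ} (hj : j ≤ d) :
    (d - 2 * j) * kraw d (i + 1) j = (d - i) * kraw d i j + (i + 2) * kraw d (i + 2) j := by
  set f : ℂ[X] := (1 - X) ^ j * (1 + X) ^ (d - j) with hf
  have h : derivative f = derivative f * X ^ 2 + C (d - 2 * j : ℂ) * f - C (d : ℂ) * (f * X) := by
    obtain ⟨m, rfl⟩ := Nat.exists_eq_add_of_le hj
    rw [hf, show j + m - j = m by omega]
    -- Differentiating a power lowers its exponent by truncated subtraction, so zero exponents are
    -- split off.
    rcases j with _ | j <;> rcases m with _ | m <;>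
    · have h2 : (C 2 : ℂ[X]) = 2 := C_ofNat 2
      simp [derivative_mul, derivative_pow, h2]
      try ring
  have h' := congrArg (fun p => p.coeff (i + 1)) h
  simp only [coeff_sub, coeff_add, coeff_C_mul, coeff_mul_X] at h'
  rcases i with _ | i
  · rw [coeff_derivative, show (X ^ 2 : ℂ[X]) = X * X by ring, ← mul_assoc, coeff_mul_X,
      mul_coeff_zero] at h'
    simp only [kraw, ← hf]
    simp at h' ⊢
    linear_combination -h'
  · rw [coeff_mul_X_pow, coeff_derivative, coeff_derivative] at h'
    simp only [kraw, ← hf]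
    push_cast at h' ⊢
    linear_combination -h'

lemma sum_kraw_mul_pow {d j : ℕ} (hj : j ≤ d) (t : ℂ) :
    ∑ i ∈ Finset.range (d + 1), kraw d i j * t ^ i = (1 - t) ^ j * (1 + t) ^ (d - j) := by
  have := eval_eq_sum_range' (Nat.lt_succ_of_le (kraw_natDegree_le hj)) t
  simpa [kraw] using this.symm

lemma sum_kraw_mul_pow_mul_pow {d j : ℕ} (hj : j ≤ d) (x : ℂ) {y : ℂ} (hy : y ≠ 0) :
    ∑ i ∈ Finset.range (d + 1), kraw d i j * (x ^ i * y ^ (d - i)) =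
      (y - x) ^ j * (y + x) ^ (d - j) := by
  have h := congrArg (· * y ^ d) (sum_kraw_mul_pow hj (x / y))
  simp only [Finset.sum_mul] at h
  convert h using 1
  · refine Finset.sum_congr rfl fun i hi => ?_
    have hi : i ≤ d := Nat.lt_succ_iff.mp (Finset.mem_range.mp hi)
    rw [div_pow, ← Nat.sub_add_cancel hi, pow_add y (d - i) i]
    simp only [Nat.sub_add_cancel hi]
    field_simp
  · rw [← Nat.add_sub_cancel' hj, pow_add y, Nat.add_sub_cancel' hj,
      show (1 - x / y) ^ j * (1 + x / y) ^ (d - j) * (y ^ j * y ^ (d - j)) =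
        ((1 - x / y) * y) ^ j * ((1 + x / y) * y) ^ (d - j) by rw [mul_pow, mul_pow]; ring]
    congr 2 <;> field_simp

/-- The value `t = -1` is excluded because the homogenised generating function is used with `y = 1 +
t ≠ 0`. -/
lemma eq_of_forall_sum_mul_pow_eq {d : ℕ} {f g : ℕ → ℂ}
    (h : ∀ t : ℂ, t ≠ -1 → ∑ i ∈ Finset.range (d + 1), f i * t ^ i =
      ∑ i ∈ Finset.range (d + 1), g i * t ^ i) {i : ℕ} (hi : i ≤ d) : f i = g i := by
  have h0 := eq_of_infinite_eval_eq (∑ i ∈ Finset.range (d + 1), C (f i) * X ^ i)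
    (∑ i ∈ Finset.range (d + 1), C (g i) * X ^ i) (by
      refine ((Set.finite_singleton (-1 : ℂ)).infinite_compl).mono fun t ht => ?_
      simpa [eval_finsetSum] using h t ht)
  have h1 := congrArg (fun p => p.coeff i) h0
  simpa [finsetSum_coeff, coeff_C_mul, coeff_X_pow, Nat.lt_succ_iff, hi] using h1

/-- The Krawtchouk matrix squares to `2^d`, because the substitution `t ↦ (1 - t)/(1 + t)` is an
involution. -/
lemma sum_kraw_mul_kraw {d i l : ℕ} (hi : i ≤ d) (hl : l ≤ d) :
    ∑ j ∈ Finset.range (d + 1), kraw d i j * kraw d j l = if i = l then 2 ^ d else 0 := by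
  refine eq_of_forall_sum_mul_pow_eq (d := d)
    (f := fun i => ∑ j ∈ Finset.range (d + 1), kraw d i j * kraw d j l)
    (g := fun i => if i = l then 2 ^ d else 0) (fun t ht => ?_) hi
  have ht : (1 + t) ≠ 0 := fun h => ht (by linear_combination h)
  have h := sum_kraw_mul_pow_mul_pow hl (1 - t) ht
  simp only [ite_mul, zero_mul, Finset.sum_ite_eq', Finset.mem_range, Nat.lt_succ_iff, hl, if_true]
  have h2 : (1 + t - (1 - t)) ^ l * (1 + t + (1 - t)) ^ (d - l) = 2 ^ d * t ^ l := by
    rw [show 1 + t - (1 - t) = 2 * t by ring, show 1 + t + (1 - t) = 2 by ring, mul_pow,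
      mul_right_comm, ← pow_add, Nat.add_sub_cancel' hl]
  rw [← h2, ← h]
  simp only [Finset.sum_mul]
  rw [Finset.sum_comm]
  refine Finset.sum_congr rfl fun j hj => ?_
  rw [← sum_kraw_mul_pow (Nat.lt_succ_iff.mp (Finset.mem_range.mp hj)), Finset.mul_sum]
  exact Finset.sum_congr rfl fun i _ => by ring

lemma sum_cubeP_mul {d c : ℕ} (hc : c ≤ d) (F G : ℕ → ℂ) :
    ∑ i ∈ Finset.range (d + 1), (∑ j ∈ Finset.range (d + 1), (cubeP d c i j : ℂ) * F j) * G i =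
      ∑ a ∈ Finset.range (c + 1), ∑ b ∈ Finset.range (d - c + 1),
        (c.choose a * (d - c).choose b : ℂ) * F (c - a + b) * G (a + b) := by
  simp only [cubeP, Nat.cast_sum, Finset.sum_mul]
  rw [Finset.sum_congr rfl fun i _ => Finset.sum_comm, Finset.sum_comm]
  refine Finset.sum_congr rfl fun a ha => ?_
  rw [Finset.sum_congr rfl fun i _ => Finset.sum_comm, Finset.sum_comm]
  refine Finset.sum_congr rfl fun b hb => ?_
  rw [Finset.mem_range, Nat.lt_succ_iff] at ha hb
  rw [Finset.sum_eq_single_of_mem (a + b) (Finset.mem_range.mpr (by omega)),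
    Finset.sum_eq_single_of_mem (c - a + b) (Finset.mem_range.mpr (by omega))]
  · rw [if_pos ⟨rfl, by omega⟩]
    push_cast
    ring
  · intro j _ hj
    rw [if_neg fun h => hj (by omega)]
    simp
  · intro i _ hi
    refine Finset.sum_eq_zero fun j _ => ?_
    rw [if_neg fun h => hi h.1.symm]
    simp

/-- This is the scalar form of `A_a E_i = K_a(i) E_i`. Summed against `s^a u^i`, both sides become
`(1 + s - u(1 - s))^c (1 + s + u(1 - s))^(d - c)`. -/
lemma sum_cubeP_mul_kraw {d c a i : ℕ} (hc : c ≤ d) (ha : a ≤ d) (hi : i ≤ d) :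
    ∑ b ∈ Finset.range (d + 1), (cubeP d c a b : ℂ) * kraw d i b = kraw d a i * kraw d i c := by
  refine eq_of_forall_sum_mul_pow_eq (d := d)
    (f := fun a => ∑ b ∈ Finset.range (d + 1), (cubeP d c a b : ℂ) * kraw d i b)
    (g := fun a => kraw d a i * kraw d i c) (fun s hs => ?_) ha
  have hs : 1 + s ≠ 0 := fun h => hs (by linear_combination h)
  refine eq_of_forall_sum_mul_pow_eq (d := d)
    (f := fun i => ∑ a ∈ Finset.range (d + 1),
      (∑ b ∈ Finset.range (d + 1), (cubeP d c a b : ℂ) * kraw d i b) * s ^ a)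
    (g := fun i => ∑ a ∈ Finset.range (d + 1), kraw d a i * kraw d i c * s ^ a)
    (fun u _ => ?_) hi
  have hr : ∑ i ∈ Finset.range (d + 1),
      (∑ a ∈ Finset.range (d + 1), kraw d a i * kraw d i c * s ^ a) * u ^ i =
      (1 + s - u * (1 - s)) ^ c * (1 + s + u * (1 - s)) ^ (d - c) := by
    rw [← sum_kraw_mul_pow_mul_pow hc _ hs]
    refine Finset.sum_congr rfl fun i hi => ?_
    rw [mul_pow, mul_assoc (u ^ i),
      ← sum_kraw_mul_pow (Nat.lt_succ_iff.mp (Finset.mem_range.mp hi)),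
      Finset.mul_sum, Finset.mul_sum, Finset.sum_mul]
    exact Finset.sum_congr rfl fun a _ => by ring
  have hl : ∑ i ∈ Finset.range (d + 1), (∑ a ∈ Finset.range (c + 1),
      ∑ b ∈ Finset.range (d - c + 1), (c.choose a * (d - c).choose b : ℂ) *
        kraw d i (c - a + b) * s ^ (a + b)) * u ^ i =
      (s * (1 + u) + (1 - u)) ^ c * (s * (1 - u) + (1 + u)) ^ (d - c) := by
    rw [add_pow, add_pow, Finset.sum_mul_sum]
    simp only [Finset.sum_mul]
    rw [Finset.sum_comm]
    refine Finset.sum_congr rfl fun a ha => ?_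
    rw [Finset.sum_comm]
    refine Finset.sum_congr rfl fun b hb => ?_
    rw [Finset.mem_range, Nat.lt_succ_iff] at ha hb
    have h := sum_kraw_mul_pow (d := d) (j := c - a + b) (by omega) u
    rw [show d - (c - a + b) = a + (d - c - b) by omega] at h
    calc _ = (c.choose a * (d - c).choose b : ℂ) * s ^ (a + b) *
          ∑ i ∈ Finset.range (d + 1), kraw d i (c - a + b) * u ^ i := by
          rw [Finset.mul_sum]
          exact Finset.sum_congr rfl fun i _ => by ring
      _ = _ := by rw [h, mul_pow, mul_pow]; ring
  rw [hr, show 1 + s - u * (1 - s) = s * (1 + u) + (1 - u) by ring,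
    show 1 + s + u * (1 - s) = s * (1 - u) + (1 + u) by ring, ← hl]
  exact Finset.sum_congr rfl fun i _ => by rw [sum_cubeP_mul hc]

lemma two_pow_mul_cubeP {d c a b : ℕ} (hc : c ≤ d) (ha : a ≤ d) (hb : b ≤ d) :
    2 ^ d * (cubeP d c a b : ℂ) =
      ∑ i ∈ Finset.range (d + 1), kraw d a i * kraw d b i * kraw d i c := by
  have h : ∀ i ∈ Finset.range (d + 1), kraw d a i * kraw d b i * kraw d i c =
      ∑ b' ∈ Finset.range (d + 1), (cubeP d c a b' : ℂ) * (kraw d b i * kraw d i b') := by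
    intro i hi
    rw [mul_right_comm, ← sum_cubeP_mul_kraw hc ha (Nat.lt_succ_iff.mp (Finset.mem_range.mp hi)),
      Finset.sum_mul]
    exact Finset.sum_congr rfl fun _ _ => by ring
  rw [Finset.sum_congr rfl h, Finset.sum_comm, Finset.sum_eq_single_of_mem b (by simp; omega)]
  · rw [← Finset.mul_sum, sum_kraw_mul_kraw hb hb, if_pos rfl, mul_comm]
  · intro b' hb' hne
    rw [← Finset.mul_sum, sum_kraw_mul_kraw hb (Nat.lt_succ_iff.mp (Finset.mem_range.mp hb')),
      if_neg hne.symm, mul_zero]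

/-- Used in two roles: as the product rule for the distance matrices, evaluated on eigenspaces, and
as the entrywise product rule for the primitive idempotents. Hence Krein parameters equal
intersection numbers. -/
lemma kraw_mul_kraw {d i j l : ℕ} (hi : i ≤ d) (hj : j ≤ d) (hl : l ≤ d) :
    kraw d i l * kraw d j l = ∑ h ∈ Finset.range (d + 1), (cubeP d h i j : ℂ) * kraw d h l := by
  have h2 : (2 ^ d : ℂ) ≠ 0 := pow_ne_zero _ two_ne_zero
  refine mul_left_cancel₀ h2 ?_
  have h : ∀ h ∈ Finset.range (d + 1), 2 ^ d * ((cubeP d h i j : ℂ) * kraw d h l) =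
      ∑ m ∈ Finset.range (d + 1), kraw d i m * kraw d j m * (kraw d m h * kraw d h l) := by
    intro h hh
    rw [← mul_assoc, two_pow_mul_cubeP (Nat.lt_succ_iff.mp (Finset.mem_range.mp hh)) hi hj,
      Finset.sum_mul]
    exact Finset.sum_congr rfl fun _ _ => by ring
  rw [Finset.mul_sum, Finset.sum_congr rfl h, Finset.sum_comm,
    Finset.sum_eq_single_of_mem l (by simp; omega)]
  · rw [← Finset.mul_sum, sum_kraw_mul_kraw hl hl, if_pos rfl, mul_comm]
  · intro m hm hne
    rw [← Finset.mul_sum, sum_kraw_mul_kraw (Nat.lt_succ_iff.mp (Finset.mem_range.mp hm)) hl,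
      if_neg hne, mul_zero]

end Krawtchouk

lemma cubeP_eq_zero_iff {d h i j : ℕ} : cubeP d h i j = 0 ↔
    ¬ ∃ a b, a ≤ h ∧ b ≤ d - h ∧ a + b = i ∧ h + b = j + a := by
  simp only [cubeP, Finset.sum_eq_zero_iff, Finset.mem_range, Nat.lt_succ_iff, not_exists]
  constructor
  · intro H a b ⟨ha, hb, hab⟩
    have := H a ha b hb
    rw [if_pos hab, mul_eq_zero, Nat.choose_eq_zero_iff, Nat.choose_eq_zero_iff] at this
    omega
  · intro H a ha b hb
    rw [if_neg fun h => H a b ⟨ha, hb, h⟩]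

lemma cubeP_zero_self {d i : ℕ} (hi : i ≤ d) : cubeP d 0 i i = d.choose i := by
  rw [cubeP, Finset.sum_range_one, Finset.sum_eq_single_of_mem i (by simp; omega)]
  · simp
  · intro b _ hb
    simp [hb]

/-! ### Path-length distance is Hamming distance; counting vertices at given distances. -/

section Distance

lemma hypercube_adj_iff {d : ℕ} {a b : Fin d → ℤˣ} :
    (hypercube d).Adj a b ↔ hammingDist a b = 1 := by
  rw [hammingDist, Finset.card_eq_one, Finset.singleton_iff_unique_mem]
  simp [hypercube]

lemma hammingDist_le_length {d : ℕ} {a b : Fin d → ℤˣ} (p : (hypercube d).Walk a b) :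
    hammingDist a b ≤ p.length := by
  induction p with
  | nil => simp
  | @cons u v w h p ih =>
    have := hammingDist_triangle u v w
    rw [hypercube_adj_iff] at h
    rw [SimpleGraph.Walk.length_cons]
    omega

lemma exists_walk_length_eq_hammingDist {d : ℕ} (n : ℕ) (a b : Fin d → ℤˣ)
    (h : hammingDist a b = n) : ∃ p : (hypercube d).Walk a b, p.length = n := by
  induction n generalizing a with
  | zero =>
    obtain rfl := hammingDist_eq_zero.mp h
    exact ⟨.nil, rfl⟩
  | succ n ih =>
    obtain ⟨i, hi⟩ : ∃ i, a i ≠ b i := by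
      by_contra! hab
      rw [funext hab, hammingDist_self] at h
      omega
    have h1 : hammingDist a (Function.update a i (b i)) = 1 := by
      rw [hammingDist, Finset.card_eq_one]
      refine ⟨i, Finset.ext fun k => ?_⟩
      rcases eq_or_ne k i with rfl | hk <;> simp [*]
    have h2 : hammingDist (Function.update a i (b i)) b = n := by
      have : (Finset.univ.filter fun k => Function.update a i (b i) k ≠ b k) =
          (Finset.univ.filter fun k => a k ≠ b k).erase i := by
        ext k
        rcases eq_or_ne k i with rfl | hk <;> simp [*]
      rw [hammingDist, this, Finset.card_erase_of_mem (by simpa using hi)]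
      rw [hammingDist] at h
      omega
    obtain ⟨p, hp⟩ := ih _ h2
    exact ⟨.cons (hypercube_adj_iff.mpr h1) p, by rw [SimpleGraph.Walk.length_cons, hp]⟩

lemma hypercube_connected (d : ℕ) : (hypercube d).Connected where
  preconnected a b := (exists_walk_length_eq_hammingDist _ a b rfl).choose.reachable

lemma hypercube_dist {d : ℕ} (a b : Fin d → ℤˣ) : (hypercube d).dist a b = hammingDist a b := by
  obtain ⟨p, hp⟩ := exists_walk_length_eq_hammingDist _ a b rfl
  obtain ⟨q, hq⟩ := (hypercube_connected d).exists_walk_length_eq_dist a b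
  exact le_antisymm (hp ▸ SimpleGraph.dist_le p) (hq ▸ hammingDist_le_length q)

lemma exists_hammingDist_eq {d h : ℕ} (hh : h ≤ d) (x : Fin d → ℤˣ) :
    ∃ y, hammingDist x y = h := by
  obtain ⟨s, -, hs⟩ := Finset.exists_subset_card_eq (s := (Finset.univ : Finset (Fin d))) (n := h)
    (by simpa using hh)
  refine ⟨fun k => if k ∈ s then -x k else x k, ?_⟩
  rw [hammingDist, ← hs]
  congr 1
  ext k
  by_cases hk : k ∈ s <;> simp [hk, units_ne_neg_self]

lemma hammingDist_le {d : ℕ} (x y : Fin d → ℤˣ) : hammingDist x y ≤ d := by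
  simpa using hammingDist_le_card_fintype (x := x) (y := y)

@[simp]
lemma hypercube_diam (d : ℕ) : (hypercube d).diam = d := by
  have htop : (hypercube d).ediam ≠ ⊤ :=
    SimpleGraph.connected_iff_ediam_ne_top.mp (hypercube_connected d)
  refine le_antisymm ?_ ?_
  · obtain ⟨u, v, huv⟩ := (hypercube d).exists_dist_eq_diam
    rw [← huv, hypercube_dist]
    exact hammingDist_le u v
  · obtain ⟨y, hy⟩ := exists_hammingDist_eq le_rfl (1 : Fin d → ℤˣ)
    have := SimpleGraph.dist_le_diam htop (u := 1) (v := y)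
    rwa [hypercube_dist, hy] at this

-- A vertex `z` is encoded by the coordinates where it differs from `x`, split into a part `A`
-- inside and a part `B` outside the set `D` where `x` and `y` differ. As there are only two signs,
-- `z` is at distance `#A + #B` from `x` and `#D - #A + #B` from `y`.
open Finset in
lemma card_hammingDist_eq {d : ℕ} (x y : Fin d → ℤˣ) (i j : ℕ) :
    #{z | hammingDist x z = i ∧ hammingDist y z = j} = cubeP d (hammingDist x y) i j := by
  set D : Finset (Fin d) := {k | x k ≠ y k} with hD
  have hDc : #Dᶜ = d - #D := by rw [card_compl, Fintype.card_fin]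
  have hu (u v w : ℤˣ) (h : u ≠ v) : v ≠ w ↔ u = w := by
    rcases Int.units_eq_one_or u with rfl | rfl <;> rcases Int.units_eq_one_or v with rfl | rfl <;>
      rcases Int.units_eq_one_or w with rfl | rfl <;> simp_all
  have hx (z : Fin d → ℤˣ) : #(D.filter fun k => x k ≠ z k) + #(Dᶜ.filter fun k => x k ≠ z k) =
      hammingDist x z := by
    rw [← card_union_of_disjoint (disjoint_filter_filter disjoint_compl_right), ← filter_union,
      union_compl, hammingDist]
  have hy (z : Fin d → ℤˣ) : hammingDist y z + #(D.filter fun k => x k ≠ z k) =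
      #D + #(Dᶜ.filter fun k => x k ≠ z k) := by
    have h1 : #(D.filter fun k => y k ≠ z k) + #(Dᶜ.filter fun k => y k ≠ z k) =
        hammingDist y z := by
      rw [← card_union_of_disjoint (disjoint_filter_filter disjoint_compl_right), ← filter_union,
        union_compl, hammingDist]
    have h2 : (D.filter fun k => y k ≠ z k) = D.filter fun k => ¬ x k ≠ z k := by
      refine filter_congr fun k hk => ?_
      rw [hu _ _ _ (by simpa [hD] using hk), not_not]
    have h3 : (Dᶜ.filter fun k => y k ≠ z k) = Dᶜ.filter fun k => x k ≠ z k := by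
      refine filter_congr fun k hk => ?_
      rw [show x k = y k by simpa [hD] using hk]
    have h4 := card_filter_add_card_filter_not (s := D) (fun k => x k ≠ z k)
    rw [h2, h3] at h1
    omega
  have hAB (A B : Finset (Fin d)) (h : A ⊆ D ∧ B ⊆ Dᶜ) :
      (D.filter fun k => x k ≠ if k ∈ A ∪ B then -x k else x k) = A ∧
        (Dᶜ.filter fun k => x k ≠ if k ∈ A ∪ B then -x k else x k) = B := by
    constructor <;>
    · ext k
      have h1 := @h.1 k
      have h2 := @h.2 k
      rw [mem_compl] at h2
      by_cases hk : k ∈ A ∪ B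
      · simp only [mem_filter, mem_compl, hk, if_true, ne_eq, units_ne_neg_self, not_false_eq_true]
        rw [mem_union] at hk
        tauto
      · simp only [mem_filter, mem_compl, hk, if_false, ne_eq, not_true_eq_false]
        rw [mem_union] at hk
        tauto
  have hcount : #{z | hammingDist x z = i ∧ hammingDist y z = j} =
      #((D.powerset ×ˢ Dᶜ.powerset).filter fun p => #p.1 + #p.2 = i ∧ #D + #p.2 = j + #p.1) := by
    refine card_nbij' (fun z => (D.filter fun k => x k ≠ z k, Dᶜ.filter fun k => x k ≠ z k))
      (fun p k => if k ∈ p.1 ∪ p.2 then -x k else x k) ?_ ?_ ?_ ?_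
    · intro z hz
      simp only [coe_filter, Set.mem_ofPred_eq, mem_univ, true_and, mem_product, mem_powerset,
        filter_subset, and_self] at hz ⊢
      rw [hx, ← hy, hz.1, hz.2]
      exact ⟨rfl, rfl⟩
    · rintro ⟨A, B⟩ hp
      simp only [coe_filter, Set.mem_ofPred_eq, mem_univ, true_and, mem_product,
        mem_powerset] at hp ⊢
      have h1 := hx fun k => if k ∈ A ∪ B then -x k else x k
      have h2 := hy fun k => if k ∈ A ∪ B then -x k else x k
      rw [(hAB A B hp.1).1, (hAB A B hp.1).2] at h1 h2
      omega
    · intro z _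
      funext k
      have : (k ∈ (D.filter fun k => x k ≠ z k) ∪ Dᶜ.filter fun k => x k ≠ z k) ↔ x k ≠ z k := by
        rw [← filter_union, union_compl, mem_filter]
        simp
      dsimp only
      simp only [this]
      split_ifs with h
      · rw [Int.units_ne_iff_eq_neg.mp h, neg_neg]
      · exact not_not.mp h
    · rintro ⟨A, B⟩ hp
      simp only [coe_filter, Set.mem_ofPred_eq, mem_product, mem_powerset] at hp
      exact Prod.ext (hAB A B hp.1).1 (hAB A B hp.1).2
  rw [hcount, card_filter, sum_product]
  rw [sum_congr rfl fun A _ => sum_powerset_apply_card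
    (f := fun b => if #A + b = i ∧ #D + b = j + #A then 1 else 0) (x := Dᶜ)]
  rw [sum_powerset_apply_card (f := fun a => ∑ b ∈ range (#Dᶜ + 1), (#Dᶜ).choose b •
    if a + b = i ∧ #D + b = j + a then 1 else 0) (x := D), hDc, cubeP]
  change _ = ∑ a ∈ range (#D + 1), _
  simp only [smul_sum, hammingDist, ← hD]
  refine sum_congr rfl fun a _ => sum_congr rfl fun b _ => ?_
  split_ifs <;> simp

end Distance

/-! ### Closed forms for the eigenvalues, idempotents, Krein parameters and coefficients of the
cube. -/

section Bridge

/-- The primitive idempotent `E_i` of the hypercube in closed form. -/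
def cubeIdem (d i : ℕ) : Matrix (Fin d → ℤˣ) (Fin d → ℤˣ) ℂ :=
  Matrix.of fun x y => (2 ^ d : ℂ)⁻¹ * kraw d i (hammingDist x y)

lemma two_pow_ne_zero (d : ℕ) : (2 ^ d : ℂ) ≠ 0 := pow_ne_zero _ two_ne_zero

lemma card_cube (d : ℕ) : (Fintype.card (Fin d → ℤˣ) : ℂ) = 2 ^ d := by
  simp

lemma hypercube_intersectionNumber {d h i j : ℕ} (hh : h ≤ d) (hi : i ≤ d) (hj : j ≤ d) :
    (hypercube d).intersectionNumber h i j = cubeP d h i j := by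
  have hc (x y : Fin d → ℤˣ) (i j : ℕ) :
      {z | (hypercube d).dist x z = i ∧ (hypercube d).dist y z = j}.ncard =
        cubeP d (hammingDist x y) i j := by
    rw [← card_hammingDist_eq, ← Set.ncard_coe_finset]
    simp [hypercube_dist]
  have hex : (hypercube d).HasIntersectionNumbers (cubeP d) := by
    intro h i j _ _ _ x y hxy
    rw [hc, ← hypercube_dist, hxy]
  have hs := Classical.epsilon_spec (p := (hypercube d).HasIntersectionNumbers) ⟨_, hex⟩
  obtain ⟨y, hy⟩ := exists_hammingDist_eq hh 1
  have := hs h i j (by simpa) (by simpa) (by simpa) 1 y (by rw [hypercube_dist, hy])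
  rw [SimpleGraph.intersectionNumber, ← this, hc, hy]

lemma sum_ite_hammingDist {d : ℕ} (x y : Fin d → ℤˣ) (a : ℕ) (F : ℕ → ℂ) :
    ∑ z, (if hammingDist x z = a then F (hammingDist y z) else 0) =
      ∑ b ∈ Finset.range (d + 1), (cubeP d (hammingDist x y) a b : ℂ) * F b := by
  have h (z : Fin d → ℤˣ) : (if hammingDist x z = a then F (hammingDist y z) else 0) =
      ∑ b ∈ Finset.range (d + 1),
        if hammingDist x z = a ∧ hammingDist y z = b then F b else 0 := by
    split_ifs with hz
    · simp [hz, hammingDist_le]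
    · simp [hz]
  simp_rw [h]
  rw [Finset.sum_comm]
  refine Finset.sum_congr rfl fun b _ => ?_
  rw [← card_hammingDist_eq, Finset.sum_ite, Finset.sum_const_zero, add_zero, Finset.sum_const,
    nsmul_eq_mul]

lemma adjMatrix_mul_cubeIdem {d i : ℕ} (hi : i ≤ d) [DecidableRel (hypercube d).Adj] :
    (hypercube d).adjMatrix ℂ * cubeIdem d i = ((d : ℂ) - 2 * i) • cubeIdem d i := by
  ext x y
  rw [Matrix.mul_apply, Matrix.smul_apply]
  simp only [SimpleGraph.adjMatrix_apply, hypercube_adj_iff, cubeIdem, Matrix.of_apply, ite_mul,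
    one_mul, zero_mul, hammingDist_comm _ y]
  rw [sum_ite_hammingDist x y 1 fun b => (2 ^ d : ℂ)⁻¹ * kraw d i b]
  rcases d.eq_zero_or_pos with rfl | hd
  · obtain rfl : i = 0 := by omega
    obtain rfl := Subsingleton.elim x y
    simp [cubeP]
  · simp only [mul_left_comm _ (2 ^ d : ℂ)⁻¹]
    rw [← Finset.mul_sum, sum_cubeP_mul_kraw (hammingDist_le x y) hd hi, kraw_one hi,
      hammingDist_comm y x, smul_eq_mul]
    ring

lemma cubeIdem_transpose (d i : ℕ) : (cubeIdem d i).transpose = cubeIdem d i := by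
  ext x y
  simp [cubeIdem, hammingDist_comm]

lemma cubeIdem_mul_adjMatrix {d i : ℕ} (hi : i ≤ d) [DecidableRel (hypercube d).Adj] :
    cubeIdem d i * (hypercube d).adjMatrix ℂ = ((d : ℂ) - 2 * i) • cubeIdem d i := by
  have := congrArg Matrix.transpose (adjMatrix_mul_cubeIdem hi)
  rwa [Matrix.transpose_mul, Matrix.transpose_smul, cubeIdem_transpose,
    SimpleGraph.transpose_adjMatrix] at this

lemma sum_cubeIdem (d : ℕ) : ∑ i ∈ Finset.range (d + 1), cubeIdem d i = 1 := by
  ext x y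
  have h := sum_kraw_mul_kraw (Nat.zero_le d) (hammingDist_le x y)
  simp only [kraw_zero_left, one_mul] at h
  rw [Matrix.sum_apply, Matrix.one_apply]
  simp only [cubeIdem, Matrix.of_apply]
  rw [← Finset.mul_sum, h]
  by_cases hxy : x = y
  · subst hxy
    simp
  · rw [if_neg (Ne.symm (hammingDist_ne_zero.mpr hxy)), if_neg hxy, mul_zero]

lemma eigenvalue_injective {d i j : ℕ} (h : (d : ℂ) - 2 * i = d - 2 * j) : i = j := by
  have : (2 : ℂ) * i = 2 * j := by linear_combination -h
  exact_mod_cast mul_left_cancel₀ two_ne_zero this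

lemma cubeIdem_mulVec {d i : ℕ} (hi : i ≤ d) [DecidableRel (hypercube d).Adj] {μ : ℂ}
    {v : (Fin d → ℤˣ) → ℂ} (hv : ((hypercube d).adjMatrix ℂ).mulVec v = μ • v)
    (hμ : μ ≠ d - 2 * i) : (cubeIdem d i).mulVec v = 0 := by
  have h : μ • (cubeIdem d i).mulVec v = ((d : ℂ) - 2 * i) • (cubeIdem d i).mulVec v := by
    rw [← Matrix.mulVec_smul, ← hv, Matrix.mulVec_mulVec, cubeIdem_mul_adjMatrix hi,
      Matrix.smul_mulVec]
  rw [← sub_eq_zero, ← sub_smul, smul_eq_zero, sub_eq_zero] at h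
  exact h.resolve_left hμ

lemma sum_cubeIdem_mulVec {d : ℕ} (v : (Fin d → ℤˣ) → ℂ) :
    ∑ i ∈ Finset.range (d + 1), (cubeIdem d i).mulVec v = v := by
  rw [← Matrix.sum_mulVec, sum_cubeIdem, Matrix.one_mulVec]

lemma cubeIdem_mulVec_eq_ite {d i j : ℕ} (hi : i ≤ d) (hj : j ≤ d)
    [DecidableRel (hypercube d).Adj] {v : (Fin d → ℤˣ) → ℂ}
    (hv : ((hypercube d).adjMatrix ℂ).mulVec v = ((d : ℂ) - 2 * j) • v) :
    (cubeIdem d i).mulVec v = if i = j then v else 0 := by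
  split_ifs with hij
  · subst hij
    conv_rhs => rw [← sum_cubeIdem_mulVec v]
    rw [Finset.sum_eq_single_of_mem i (by simp; omega)]
    intro k hk hki
    exact cubeIdem_mulVec (Nat.lt_succ_iff.mp (Finset.mem_range.mp hk)) hv
      fun h => hki (eigenvalue_injective h).symm
  · exact cubeIdem_mulVec hi hv fun h => hij (eigenvalue_injective h).symm

lemma cubeIdem_apply_self {d i : ℕ} (hi : i ≤ d) (x : Fin d → ℤˣ) : cubeIdem d i x x ≠ 0 := by
  have : d.choose i ≠ 0 := (Nat.choose_pos hi).ne'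
  simp [cubeIdem, kraw_zero_right, this]

lemma adjMatrix_mulVec_cubeIdem {d i : ℕ} (hi : i ≤ d) [DecidableRel (hypercube d).Adj]
    (v : (Fin d → ℤˣ) → ℂ) : ((hypercube d).adjMatrix ℂ).mulVec ((cubeIdem d i).mulVec v) =
      ((d : ℂ) - 2 * i) • (cubeIdem d i).mulVec v := by
  rw [Matrix.mulVec_mulVec, adjMatrix_mul_cubeIdem hi, Matrix.smul_mulVec]

lemma apply_self_of_mulVec_single_eq_zero {V : Type*} [Fintype V] [DecidableEq V]
    {M : Matrix V V ℂ} {x : V} (h : M.mulVec (Pi.single x 1) = 0) : M x x = 0 := by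
  simpa using congrFun h x

lemma hypercube_hasEigenvalue_iff {d : ℕ} [DecidableRel (hypercube d).Adj] (μ : ℂ) :
    Module.End.HasEigenvalue (Matrix.toLin' ((hypercube d).adjMatrix ℂ)) μ ↔
      ∃ i ≤ d, (d : ℂ) - 2 * i = μ := by
  constructor
  · intro h
    obtain ⟨v, hv⟩ := h.exists_hasEigenvector
    have hv1 := hv.apply_eq_smul
    rw [Matrix.toLin'_apply] at hv1
    by_contra! hμ
    refine hv.2 ?_
    rw [← sum_cubeIdem_mulVec v]
    refine Finset.sum_eq_zero fun i hi => ?_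
    have hi := Nat.lt_succ_iff.mp (Finset.mem_range.mp hi)
    exact cubeIdem_mulVec hi hv1 (hμ i hi).symm
  · rintro ⟨i, hi, rfl⟩
    obtain ⟨x⟩ : Nonempty (Fin d → ℤˣ) := inferInstance
    refine Module.End.hasEigenvalue_of_hasEigenvector
      (x := (cubeIdem d i).mulVec (Pi.single x 1)) ⟨?_, fun h => cubeIdem_apply_self hi x ?_⟩
    · rw [Module.End.mem_eigenspace_iff, Matrix.toLin'_apply, adjMatrix_mulVec_cubeIdem hi]
    · exact apply_self_of_mulVec_single_eq_zero h

/-- A strictly decreasing sequence is determined by its range, so the chosen sequence is the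
explicit one. -/
lemma hypercube_theta {d i : ℕ} (hi : i ≤ d) : (hypercube d).theta i = d - 2 * i := by
  have hex : (hypercube d).IsEigenvalueSeq fun i => (d : ℝ) - 2 * i := by
    refine ⟨fun a _ b _ hab => ?_, fun μ => ?_⟩
    · have : (a : ℝ) < b := by exact_mod_cast hab
      linarith
    · exact (@hypercube_hasEigenvalue_iff d (fun _ _ => Classical.propDecidable _) μ).trans
        (by simp)
  have hs := Classical.epsilon_spec (p := (hypercube d).IsEigenvalueSeq) ⟨_, hex⟩
  change (hypercube d).IsEigenvalueSeq (hypercube d).theta at hs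
  have hm {θ : ℕ → ℝ} (h : (hypercube d).IsEigenvalueSeq θ) :
      StrictAnti fun i : Fin (d + 1) => θ i := fun a b hab =>
    h.1 (by simpa using Nat.lt_succ_iff.mp a.2) (by simpa using Nat.lt_succ_iff.mp b.2) hab
  have hr {θ : ℕ → ℝ} (h : (hypercube d).IsEigenvalueSeq θ) (r : ℝ) :
      r ∈ Set.range (fun i : Fin (d + 1) => θ i) ↔
        ∃ i ≤ d, (d : ℂ) - 2 * i = (r : ℂ) := by
    refine Iff.trans ?_ ((h.2 r).symm.trans
      (@hypercube_hasEigenvalue_iff d (fun _ _ => Classical.propDecidable _) r))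
    rw [hypercube_diam]
    constructor
    · rintro ⟨i, rfl⟩
      exact ⟨i, Nat.lt_succ_iff.mp i.2, rfl⟩
    · rintro ⟨i, hi, h⟩
      exact ⟨⟨i, Nat.lt_succ_of_le hi⟩, by exact_mod_cast h⟩
  have := (StrictAnti.range_inj (hm hs) (hm hex)).mp
    (Set.ext fun r => (hr hs r).trans (hr hex r).symm)
  exact congrFun this ⟨i, Nat.lt_succ_of_le hi⟩

/-- The defining property prescribes the action on eigenvectors, and every vector is the sum of its
eigencomponents by `sum_cubeIdem_mulVec`. -/
lemma hypercube_primitiveIdempotent {d i : ℕ} (hi : i ≤ d) :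
    (hypercube d).primitiveIdempotent i = cubeIdem d i := by
  classical
  have hθ {j : ℕ} (hj : j ≤ d) : (((hypercube d).theta j : ℝ) : ℂ) = d - 2 * j := by
    rw [hypercube_theta hj]
    simp
  have hex : (hypercube d).ArePrimitiveIdempotents (cubeIdem d) := by
    intro i hi j hj v hv
    rw [hypercube_diam] at hi hj
    rw [hθ hj] at hv
    exact cubeIdem_mulVec_eq_ite hi hj hv
  have hs := Classical.epsilon_spec (p := (hypercube d).ArePrimitiveIdempotents) ⟨_, hex⟩
  change (hypercube d).ArePrimitiveIdempotents (hypercube d).primitiveIdempotent at hs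
  refine Matrix.ext_of_mulVec_single fun x => ?_
  set v : (Fin d → ℤˣ) → ℂ := Pi.single x 1
  rw [← sum_cubeIdem_mulVec v, Matrix.mulVec_sum, Matrix.mulVec_sum]
  refine Finset.sum_congr rfl fun j hj => ?_
  have hj := Nat.lt_succ_iff.mp (Finset.mem_range.mp hj)
  have h1 := adjMatrix_mulVec_cubeIdem hj v
  rw [cubeIdem_mulVec_eq_ite hi hj h1]
  refine hs i (by simpa) j (by simpa) _ ?_
  rw [hθ hj]
  convert h1

/-- Existence makes the chosen coefficients valid, and uniqueness up to index `D` identifies them.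
-/
lemma coords_eq {M : Type*} [AddCommMonoid M] [Module ℂ M] {b : ℕ → M} {D : ℕ} {m : M}
    {c : ℕ → ℂ} (hm : m = ∑ j ∈ Finset.range (D + 1), c j • b j)
    (hb : ∀ c' : ℕ → ℂ, ∑ j ∈ Finset.range (D + 1), c' j • b j =
      ∑ j ∈ Finset.range (D + 1), c j • b j → ∀ j ≤ D, c' j = c j) {j : ℕ} (hj : j ≤ D) :
    coords b D m j = c j :=
  hb _ ((Classical.epsilon_spec (p := fun c : ℕ → ℂ =>
    m = ∑ j ∈ Finset.range (D + 1), c j • b j) ⟨c, hm⟩).symm.trans hm) j hj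

lemma kraw_coeff_injective {d : ℕ} {c c' : ℕ → ℂ}
    (h : ∀ l ≤ d, ∑ i ∈ Finset.range (d + 1), c' i * kraw d i l =
      ∑ i ∈ Finset.range (d + 1), c i * kraw d i l) {j : ℕ} (hj : j ≤ d) : c' j = c j := by
  have hc (c : ℕ → ℂ) : ∑ l ∈ Finset.range (d + 1),
      (∑ i ∈ Finset.range (d + 1), c i * kraw d i l) * kraw d l j = c j * 2 ^ d := by
    simp only [Finset.sum_mul]
    rw [Finset.sum_comm, Finset.sum_eq_single_of_mem j (by simp; omega)]
    · simp only [mul_assoc]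
      rw [← Finset.mul_sum, sum_kraw_mul_kraw hj hj, if_pos rfl]
    · intro i hi hij
      simp only [mul_assoc]
      rw [← Finset.mul_sum, sum_kraw_mul_kraw (Nat.lt_succ_iff.mp (Finset.mem_range.mp hi)) hj,
        if_neg hij, mul_zero]
  refine mul_right_cancel₀ (two_pow_ne_zero d) ?_
  rw [← hc, ← hc]
  exact Finset.sum_congr rfl fun l hl => by
    rw [h l (Nat.lt_succ_iff.mp (Finset.mem_range.mp hl))]

lemma hypercube_qCoeff {d i j : ℕ} (hi : i ≤ d) (hj : j ≤ d) :
    (hypercube d).qCoeff i j = kraw d i j := by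
  have hA (c : ℕ → ℂ) (x y : Fin d → ℤˣ) :
      (∑ j ∈ Finset.range (d + 1), c j • (hypercube d).distMatrix j) x y =
        c (hammingDist x y) := by
    simp [Matrix.sum_apply, SimpleGraph.distMatrix, hypercube_dist, hammingDist_le]
  rw [SimpleGraph.qCoeff, hypercube_diam]
  refine coords_eq (c := kraw d i) ?_ (fun c' h l hl => ?_) hj
  · ext x y
    rw [hA, hypercube_primitiveIdempotent hi, Matrix.smul_apply, card_cube, cubeIdem,
      Matrix.of_apply, smul_eq_mul, mul_inv_cancel_left₀ (two_pow_ne_zero d)]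
  · obtain ⟨y, rfl⟩ := exists_hammingDist_eq hl 1
    rw [← hA c', h, hA]

lemma hypercube_kreinParameter {d h i j : ℕ} (hh : h ≤ d) (hi : i ≤ d) (hj : j ≤ d) :
    (hypercube d).kreinParameter h i j = cubeP d h i j := by
  have hE (c : ℕ → ℂ) (x y : Fin d → ℤˣ) :
      (∑ l ∈ Finset.range (d + 1), c l • (hypercube d).primitiveIdempotent l) x y =
        (2 ^ d)⁻¹ * ∑ l ∈ Finset.range (d + 1), c l * kraw d l (hammingDist x y) := by
    rw [Matrix.sum_apply, Finset.mul_sum]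
    refine Finset.sum_congr rfl fun l hl => ?_
    rw [hypercube_primitiveIdempotent (Nat.lt_succ_iff.mp (Finset.mem_range.mp hl)),
      Matrix.smul_apply, cubeIdem, Matrix.of_apply, smul_eq_mul]
    ring
  rw [SimpleGraph.kreinParameter, hypercube_diam]
  refine coords_eq (c := fun h => (cubeP d h i j : ℂ)) ?_ (fun c' H l hl => ?_) hh
  · ext x y
    rw [hE, ← kraw_mul_kraw hi hj (hammingDist_le x y), hypercube_primitiveIdempotent hi,
      hypercube_primitiveIdempotent hj, Matrix.smul_apply, Matrix.hadamard_apply, card_cube,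
      cubeIdem, cubeIdem, Matrix.of_apply, Matrix.of_apply, smul_eq_mul]
    have := two_pow_ne_zero d
    field_simp
  · refine kraw_coeff_injective (c := fun h => (cubeP d h i j : ℂ)) (fun l hl => ?_) hl
    obtain ⟨y, rfl⟩ := exists_hammingDist_eq hl 1
    refine mul_left_cancel₀ (inv_ne_zero (two_pow_ne_zero d)) ?_
    rw [← hE c' 1 y, H, hE]

lemma hypercube_dualQCoeff {d i j : ℕ} (hi : i ≤ d) (hj : j ≤ d) :
    (hypercube d).dualQCoeff i j = kraw d i j := by
  have hE (c : ℕ → ℂ) (x y z : Fin d → ℤˣ) : (∑ l ∈ Finset.range (d + 1),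
      c l • fun x => (hypercube d).dualDistMatrix x l) x y z =
        if y = z then ∑ l ∈ Finset.range (d + 1), c l * kraw d l (hammingDist x y) else 0 := by
    rw [Finset.sum_apply, Matrix.sum_apply]
    split_ifs with hyz
    · subst hyz
      refine Finset.sum_congr rfl fun l hl => ?_
      simp only [Pi.smul_apply, Matrix.smul_apply, SimpleGraph.dualDistMatrix,
        Matrix.diagonal_apply_eq, card_cube,
        hypercube_primitiveIdempotent (Nat.lt_succ_iff.mp (Finset.mem_range.mp hl)), cubeIdem,
        Matrix.of_apply, mul_inv_cancel_left₀ (two_pow_ne_zero d), smul_eq_mul]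
    · refine Finset.sum_eq_zero fun l _ => ?_
      simp only [Pi.smul_apply, Matrix.smul_apply, SimpleGraph.dualDistMatrix,
        Matrix.diagonal_apply, if_neg hyz, smul_zero]
  rw [SimpleGraph.dualQCoeff, hypercube_diam]
  refine coords_eq (c := kraw d i) ?_ (fun c' H l hl => ?_) hj
  · funext x
    ext y z
    rw [hE, sum_kraw_mul_kraw hi (hammingDist_le x y)]
    simp only [Pi.smul_apply, Matrix.smul_apply, SimpleGraph.dualPrimitiveIdempotent,
      Matrix.diagonal_apply, card_cube, hypercube_dist, smul_eq_mul, mul_ite, mul_one, mul_zero,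
      eq_comm (a := i)]
  · refine kraw_coeff_injective (fun l hl => ?_) hl
    obtain ⟨y, rfl⟩ := exists_hammingDist_eq hl 1
    have := congrFun (congrFun (congrFun H 1) y) y
    rwa [hE, hE, if_pos rfl, if_pos rfl] at this

end Bridge

/-! ### Abstract idempotent systems and cube pairs. -/

section Abstract

variable {B : Type*} [Ring B] {d : ℕ} {e es : ℕ → B}

/-- `e 0, …, e d` are mutually orthogonal idempotents with sum `1`, and `e i = 0` for `i > d`. -/
structure IsIdempotentSystem (d : ℕ) (e : ℕ → B) : Prop where
  mul_eq : ∀ i j, e i * e j = if i = j then e i else 0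
  sum_eq : ∑ i ∈ Finset.range (d + 1), e i = 1

namespace IsIdempotentSystem

variable (s : IsIdempotentSystem d e)
include s

lemma mul_self (i : ℕ) : e i * e i = e i := by rw [s.mul_eq, if_pos rfl]

lemma mul_ne {i j : ℕ} (h : i ≠ j) : e i * e j = 0 := by rw [s.mul_eq, if_neg h]

lemma sum_mul (x : B) : ∑ i ∈ Finset.range (d + 1), e i * x = x := by
  rw [← Finset.sum_mul, s.sum_eq, one_mul]

lemma mul_sum (x : B) : ∑ i ∈ Finset.range (d + 1), x * e i = x := by
  rw [← Finset.mul_sum, s.sum_eq, mul_one]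

lemma eq_zero {i : ℕ} (hi : d < i) : e i = 0 := by
  rw [← s.mul_sum (e i)]
  refine Finset.sum_eq_zero fun j hj => s.mul_ne ?_
  have := Finset.mem_range.mp hj
  omega

lemma ext_right {x y : B} (h : ∀ i ≤ d, x * e i = y * e i) : x = y := by
  rw [← s.mul_sum x, ← s.mul_sum y]
  exact Finset.sum_congr rfl fun i hi => h i (Nat.lt_succ_iff.mp (Finset.mem_range.mp hi))

lemma ext_left {x y : B} (h : ∀ i ≤ d, e i * x = e i * y) : x = y := by
  rw [← s.sum_mul x, ← s.sum_mul y]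
  exact Finset.sum_congr rfl fun i hi => h i (Nat.lt_succ_iff.mp (Finset.mem_range.mp hi))

end IsIdempotentSystem

variable [Algebra ℂ B]

/-- The element `∑_j K_i(j) e_j`, which plays the role of the `i`th distance matrix. -/
def krawSum (d : ℕ) (e : ℕ → B) (i : ℕ) : B := ∑ j ∈ Finset.range (d + 1), kraw d i j • e j

/-- Two systems of idempotents `e`, `es`, each of which acts on the other in a tridiagonal
fashion, with the eigenvalues of the hypercube. -/
structure IsCubePair (d : ℕ) (e es : ℕ → B) : Prop where
  left : IsIdempotentSystem d e
  right : IsIdempotentSystem d es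
  tri : ∀ h k, h ≠ k + 1 → k ≠ h + 1 → es h * krawSum d e 1 * es k = 0
  tri_dual : ∀ h k, h ≠ k + 1 → k ≠ h + 1 → e h * krawSum d es 1 * e k = 0

lemma IsCubePair.symm (p : IsCubePair d e es) : IsCubePair d es e :=
  ⟨p.right, p.left, p.tri_dual, p.tri⟩

namespace IsIdempotentSystem

variable (s : IsIdempotentSystem d e)
include s

lemma krawSum_mul_idem {i j : ℕ} : krawSum d e i * e j = kraw d i j • e j := by
  rcases le_or_gt j d with hj | hj
  · rw [krawSum, Finset.sum_mul, Finset.sum_eq_single_of_mem j (by simp; omega)]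
    · rw [smul_mul_assoc, s.mul_self]
    · intro k _ hk
      rw [smul_mul_assoc, s.mul_ne hk, smul_zero]
  · rw [s.eq_zero hj, mul_zero, smul_zero]

lemma idem_mul_krawSum {i j : ℕ} : e j * krawSum d e i = kraw d i j • e j := by
  rcases le_or_gt j d with hj | hj
  · rw [krawSum, Finset.mul_sum, Finset.sum_eq_single_of_mem j (by simp; omega)]
    · rw [mul_smul_comm, s.mul_self]
    · intro k _ hk
      rw [mul_smul_comm, s.mul_ne hk.symm, smul_zero]
  · rw [s.eq_zero hj, zero_mul, smul_zero]

lemma krawSum_zero : krawSum d e 0 = 1 := by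
  rw [krawSum, ← s.sum_eq]
  exact Finset.sum_congr rfl fun i _ => by rw [kraw_zero_left, one_smul]

lemma krawSum_one_mul_idem {j : ℕ} : krawSum d e 1 * e j = ((d : ℂ) - 2 * j) • e j := by
  rcases le_or_gt j d with hj | hj
  · rw [s.krawSum_mul_idem, kraw_one hj]
  · rw [s.eq_zero hj, mul_zero, smul_zero]

lemma idem_mul_krawSum_one {j : ℕ} : e j * krawSum d e 1 = ((d : ℂ) - 2 * j) • e j := by
  rcases le_or_gt j d with hj | hj
  · rw [s.idem_mul_krawSum, kraw_one hj]
  · rw [s.eq_zero hj, zero_mul, smul_zero]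

lemma krawSum_mul_krawSum {i j : ℕ} (hi : i ≤ d) (hj : j ≤ d) :
    krawSum d e i * krawSum d e j =
      ∑ h ∈ Finset.range (d + 1), (cubeP d h i j : ℂ) • krawSum d e h := by
  refine s.ext_right fun l hl => ?_
  rw [mul_assoc, s.krawSum_mul_idem, mul_smul_comm, s.krawSum_mul_idem, smul_smul, mul_comm,
    kraw_mul_kraw hi hj hl, Finset.sum_smul, Finset.sum_mul]
  exact Finset.sum_congr rfl fun h _ => by rw [smul_mul_assoc, s.krawSum_mul_idem, smul_smul]

omit s in
lemma sum_kraw_smul_krawSum (e : ℕ → B) {i : ℕ} (hi : i ≤ d) :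
    ∑ j ∈ Finset.range (d + 1), kraw d i j • krawSum d e j = (2 : ℂ) ^ d • e i := by
  simp only [krawSum, Finset.smul_sum, smul_smul]
  rw [Finset.sum_comm, Finset.sum_eq_single_of_mem i (by simp; omega)]
  · rw [← Finset.sum_smul, sum_kraw_mul_kraw hi hi, if_pos rfl]
  · intro k hk hki
    rw [← Finset.sum_smul, sum_kraw_mul_kraw hi (Nat.lt_succ_iff.mp (Finset.mem_range.mp hk)),
      if_neg hki.symm, zero_smul]

omit s in
lemma idem_eq_sum (e : ℕ → B) {i : ℕ} (hi : i ≤ d) :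
    e i = ((2 : ℂ) ^ d)⁻¹ • ∑ j ∈ Finset.range (d + 1), kraw d i j • krawSum d e j := by
  rw [sum_kraw_smul_krawSum e hi, inv_smul_smul₀ (two_pow_ne_zero d)]

lemma krawSum_recurrence (i : ℕ) : krawSum d e 1 * krawSum d e (i + 1) =
    ((d : ℂ) - i) • krawSum d e i + ((i : ℂ) + 2) • krawSum d e (i + 2) := by
  refine s.ext_right fun j hj => ?_
  rw [mul_assoc, s.krawSum_mul_idem, mul_smul_comm, s.krawSum_one_mul_idem, smul_smul, mul_comm,
    kraw_recurrence hj, add_mul (_ • krawSum d e i), smul_mul_assoc, smul_mul_assoc,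
    s.krawSum_mul_idem, s.krawSum_mul_idem, smul_smul, smul_smul, add_smul]

omit s in
lemma krawSum_eq_zero (e : ℕ → B) {i : ℕ} (hi : d < i) : krawSum d e i = 0 :=
  Finset.sum_eq_zero fun j hj => by
    rw [kraw_eq_zero (Nat.lt_succ_iff.mp (Finset.mem_range.mp hj)) hi, zero_smul]

end IsIdempotentSystem

/-! ### From the tridiagonal relations to all triple product relations. -/

namespace IsCubePair

variable (p : IsCubePair d e es)
include p

/-- Between `e a` and `e b` every term is a scalar multiple of `e a * krawSum d es 1 * e b`, which
vanishes unless `a` and `b` differ by 1. In those two cases the scalars agree by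
`kraw_sub_kraw_succ` at levels `i` and `i + 1`. -/
lemma commutator_identity (i : ℕ) :
    krawSum d e (i + 2) * krawSum d es 1 - krawSum d e i * krawSum d es 1
      - krawSum d es 1 * krawSum d e (i + 2) - krawSum d es 1 * krawSum d e i =
    (krawSum d e 1 * krawSum d es 1 - krawSum d es 1 * krawSum d e 1) * krawSum d e (i + 1) := by
  have s := p.left
  have hl (j a b : ℕ) : e a * (krawSum d e j * krawSum d es 1 * e b) =
      kraw d j a • (e a * krawSum d es 1 * e b) := by
    rw [← mul_assoc, ← mul_assoc, s.idem_mul_krawSum, smul_mul_assoc, smul_mul_assoc]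
  have hr (j a b : ℕ) : e a * (krawSum d es 1 * krawSum d e j * e b) =
      kraw d j b • (e a * krawSum d es 1 * e b) := by
    rw [mul_assoc, s.krawSum_mul_idem, mul_smul_comm, mul_smul_comm, ← mul_assoc]
  refine s.ext_right fun b hb => s.ext_left fun a ha => ?_
  rw [mul_assoc _ (krawSum d e (i + 1)), s.krawSum_mul_idem, mul_smul_comm, mul_smul_comm]
  simp only [sub_mul, mul_sub, hl, hr]
  rw [kraw_one ha, kraw_one hb]
  by_cases h1 : a = b + 1
  · subst h1
    have h1 := kraw_sub_kraw_succ (i := i) (show b < d by omega)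
    have h2 := kraw_sub_kraw_succ (i := i + 1) (show b < d by omega)
    simp only [← sub_smul, smul_smul]
    congr 1
    push_cast
    linear_combination h1 - h2
  · by_cases h2 : b = a + 1
    · subst h2
      have h1 := kraw_sub_kraw_succ (i := i) (show a < d by omega)
      have h2 := kraw_sub_kraw_succ (i := i + 1) (show a < d by omega)
      simp only [← sub_smul, smul_smul]
      congr 1
      push_cast
      linear_combination h1 + h2
    · rw [p.tri_dual a b h1 h2]
      simp

/-- With `Z = 2A + ε[A, G]`, the component `es h * Z * es k` is `2(1 + ε(h - k))` times that of `A`.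
Thus `ε = 1` retains only `k = h - 1` and `ε = -1` only `k = h + 1`. When the retained neighbours
vanish at level `i + 1`, expanding `Z * krawSum d e (i + 1)` by the recurrence and the commutator
identity ties level `i + 2` to level `i`. -/
lemma ladder_identity (ε : ℂ) {h i j : ℕ}
    (H : ∀ k, (h = k + 1 ∨ k = h + 1) → 1 + ε * (h - k) ≠ 0 →
      es k * krawSum d e (i + 1) * es j = 0) :
    ((i : ℂ) + 2 + ε * (h - j)) • (es h * krawSum d e (i + 2) * es j) +
      ((d : ℂ) - i - ε * (d - h - j)) • (es h * krawSum d e i * es j) = 0 := by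
  have s := p.right
  set A := krawSum d e 1
  set G := krawSum d es 1 with hG
  set Z := (2 : ℂ) • A + ε • (A * G - G * A)
  have h0 : es h * (Z * krawSum d e (i + 1) * es j) = 0 := by
    rw [mul_assoc, ← s.sum_mul (krawSum d e (i + 1) * es j), Finset.mul_sum, Finset.mul_sum]
    refine Finset.sum_eq_zero fun k _ => ?_
    have hk : es h * (Z * es k) = ((2 : ℂ) * (1 + ε * (h - k))) • (es h * A * es k) := by
      have h1 : es h * (A * G * es k) = ((d : ℂ) - 2 * k) • (es h * A * es k) := by
        rw [mul_assoc, s.krawSum_one_mul_idem, mul_smul_comm, mul_smul_comm, mul_assoc]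
      have h2 : es h * (G * A * es k) = ((d : ℂ) - 2 * h) • (es h * A * es k) := by
        rw [mul_assoc, ← mul_assoc, s.idem_mul_krawSum_one, smul_mul_assoc, mul_assoc]
      simp only [Z, add_mul, sub_mul, mul_add, mul_sub, smul_mul_assoc, mul_smul_comm, h1, h2,
        ← mul_assoc]
      module
    rw [← mul_assoc Z, ← mul_assoc, hk, ← mul_assoc, smul_mul_assoc, smul_mul_assoc]
    by_cases hadj : h = k + 1 ∨ k = h + 1
    · by_cases hz : 1 + ε * ((h : ℂ) - k) = 0
      · rw [hz, mul_zero, zero_smul]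
      · rw [mul_assoc _ (krawSum d e (i + 1)), mul_assoc _ (es k), ← mul_assoc (es k),
          H k hadj hz, mul_zero, smul_zero]
    · rw [not_or] at hadj
      rw [p.tri h k hadj.1 hadj.2, zero_mul, zero_mul, smul_zero]
  have h1 : Z * krawSum d e (i + 1) =
      (2 : ℂ) • (((d : ℂ) - i) • krawSum d e i + ((i : ℂ) + 2) • krawSum d e (i + 2)) +
        ε • (krawSum d e (i + 2) * G - krawSum d e i * G - G * krawSum d e (i + 2)
          - G * krawSum d e i) := by
    rw [← p.left.krawSum_recurrence, p.commutator_identity]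
    simp only [Z, add_mul, smul_mul_assoc]
    rfl
  have hr (x : B) : es h * (x * G * es j) = ((d : ℂ) - 2 * j) • (es h * x * es j) := by
    rw [mul_assoc, s.krawSum_one_mul_idem, mul_smul_comm, mul_smul_comm, mul_assoc]
  have hl (x : B) : es h * (G * x * es j) = ((d : ℂ) - 2 * h) • (es h * x * es j) := by
    rw [mul_assoc, ← mul_assoc, s.idem_mul_krawSum_one, smul_mul_assoc, mul_assoc]
  rw [h1] at h0
  simp only [add_mul, sub_mul, mul_add, mul_sub, smul_mul_assoc, mul_smul_comm, hl, hr,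
    ← mul_assoc] at h0
  -- The expanded relation carries an overall factor 2, so zero is replaced by half of that
  -- relation, leaving a linear identity.
  have h2 : (2 : ℂ)⁻¹ • (0 : B) = 0 := smul_zero _
  rw [← h0] at h2
  rw [← h0, ← h2]
  module

/-- Both neighbours vanish by parity, so both signs of `ε` apply; adding the two relations leaves
the nonzero coefficient `2(i + 2)`. -/
lemma triple_eq_zero_of_odd (i h j : ℕ) (hodd : Odd (h + i + j)) :
    es h * krawSum d e i * es j = 0 := by
  induction i using Nat.twoStepInduction generalizing h j with
  | zero =>
    rw [p.left.krawSum_zero, mul_one, p.right.mul_ne]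
    rintro rfl
    grind
  | one => exact p.tri h j (by grind) (by grind)
  | more i ih1 ih2 =>
    have H (ε : ℂ) := p.ladder_identity ε (h := h) (i := i) (j := j)
      fun k hk _ => ih2 k j (by grind)
    have h1 := H 1
    have h2 := H (-1)
    rw [ih1 h j (by grind), smul_zero, add_zero] at h1 h2
    have h3 : ((2 : ℂ) * (i + 2)) • (es h * krawSum d e (i + 2) * es j) = 0 := by
      rw [show (2 : ℂ) * (i + 2) =
          (i + 2 + 1 * ((h : ℂ) - j)) + (i + 2 + -1 * ((h : ℂ) - j)) by ring,
        add_smul, h1, h2, add_zero]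
    refine (smul_eq_zero.mp h3).resolve_left ?_
    norm_cast

/-- Ascending induction on `i` with `ε = 1`: only `k = h - 1` is retained, and it stays in the
region. -/
lemma triple_eq_zero_of_add_left_lt (i h j : ℕ) (hlt : i + h < j) :
    es h * krawSum d e i * es j = 0 := by
  induction i using Nat.twoStepInduction generalizing h with
  | zero =>
    rw [p.left.krawSum_zero, mul_one, p.right.mul_ne]
    omega
  | one => exact p.tri h j (by omega) (by omega)
  | more i ih1 ih2 =>
    have H := p.ladder_identity 1 (h := h) (i := i) (j := j) fun k hk hz => by
      rcases hk with hk | hk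
      · exact ih2 k (by omega)
      · subst hk
        push_cast at hz
        exact absurd (by ring) hz
    rw [ih1 h (by omega), smul_zero, add_zero] at H
    refine (smul_eq_zero.mp H).resolve_left fun hz => ?_
    have : ((i + 2 + h : ℕ) : ℂ) = (j : ℕ) := by push_cast; linear_combination hz
    norm_cast at this
    omega

lemma triple_eq_zero_of_add_right_lt (i h j : ℕ) (hlt : i + j < h) :
    es h * krawSum d e i * es j = 0 := by
  induction i using Nat.twoStepInduction generalizing h with
  | zero =>
    rw [p.left.krawSum_zero, mul_one, p.right.mul_ne]
    omega
  | one => exact p.tri h j (by omega) (by omega)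
  | more i ih1 ih2 =>
    have H := p.ladder_identity (-1) (h := h) (i := i) (j := j) fun k hk hz => by
      rcases hk with hk | hk
      · subst hk
        push_cast at hz
        exact absurd (by ring) hz
      · exact ih2 k (by omega)
    rw [ih1 h (by omega), smul_zero, add_zero] at H
    refine (smul_eq_zero.mp H).resolve_left fun hz => ?_
    have : ((i + 2 + j : ℕ) : ℂ) = (h : ℕ) := by push_cast; linear_combination hz
    norm_cast at this
    omega

/-- Descending induction on `i`, starting beyond `d` where `krawSum` vanishes. With `ε = 1` the
coefficient at level `i` is `h + j - i ≠ 0`. -/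
lemma triple_eq_zero_of_lt (i h j : ℕ) (hlt : h + j < i) :
    es h * krawSum d e i * es j = 0 := by
  obtain ⟨n, hn⟩ : ∃ n, d < i + n := ⟨d + 1, by omega⟩
  induction n generalizing h i with
  | zero => rw [IsIdempotentSystem.krawSum_eq_zero (i := i) e hn, mul_zero, zero_mul]
  | succ n ih =>
    have H := p.ladder_identity 1 (h := h) (i := i) (j := j) fun k hk hz => by
      rcases hk with hk | hk
      · exact ih (i + 1) k (by omega) (by omega)
      · subst hk
        push_cast at hz
        exact absurd (by ring) hz
    rw [ih (i + 2) h (by omega) (by omega), smul_zero, zero_add] at H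
    refine (smul_eq_zero.mp H).resolve_left fun hz => ?_
    have : ((h + j : ℕ) : ℂ) = (i : ℕ) := by push_cast; linear_combination hz
    norm_cast at this
    omega

/-- Descending induction again, now with `ε = -1`, where the coefficient at level `i` is `2d - h - i
- j`. -/
lemma triple_eq_zero_of_two_mul_lt (i h j : ℕ) (hlt : 2 * d < h + i + j) :
    es h * krawSum d e i * es j = 0 := by
  obtain ⟨n, hn⟩ : ∃ n, d < i + n := ⟨d + 1, by omega⟩
  induction n generalizing h i with
  | zero => rw [IsIdempotentSystem.krawSum_eq_zero (i := i) e hn, mul_zero, zero_mul]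
  | succ n ih =>
    have H := p.ladder_identity (-1) (h := h) (i := i) (j := j) fun k hk hz => by
      rcases hk with hk | hk
      · subst hk
        push_cast at hz
        exact absurd (by ring) hz
      · exact ih (i + 1) k (by omega) (by omega)
    rw [ih (i + 2) h (by omega) (by omega), smul_zero, zero_add] at H
    refine (smul_eq_zero.mp H).resolve_left fun hz => ?_
    have : ((2 * d : ℕ) : ℂ) = (h + i + j : ℕ) := by push_cast; linear_combination hz
    norm_cast at this
    omega

/-- The triple product relations follow from the tridiagonal ones. -/
lemma triple_eq_zero {h i j : ℕ} (hP : cubeP d h i j = 0) :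
    es h * krawSum d e i * es j = 0 := by
  rw [cubeP_eq_zero_iff] at hP
  by_contra hne
  have h1 : ¬ Odd (h + i + j) := fun H => hne (p.triple_eq_zero_of_odd i h j H)
  have h2 : ¬ i + h < j := fun H => hne (p.triple_eq_zero_of_add_left_lt i h j H)
  have h3 : ¬ i + j < h := fun H => hne (p.triple_eq_zero_of_add_right_lt i h j H)
  have h4 : ¬ h + j < i := fun H => hne (p.triple_eq_zero_of_lt i h j H)
  have h5 : ¬ 2 * d < h + i + j := fun H => hne (p.triple_eq_zero_of_two_mul_lt i h j H)
  rw [Nat.not_odd_iff_even] at h1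
  obtain ⟨m, hm⟩ := h1
  -- Outside the five regions `h + i + j = 2m`, and `a + b = i`, `h + b = j + a` have the solution
  -- `a = m - j`, `b = m - h`; the triangle inequalities and `m ≤ d` bound it.
  exact hP ⟨m - j, m - h, by omega, by omega, by omega, by omega⟩

end IsCubePair

end Abstract

/-! ### The element u_0: self-duality, centrality, idempotence, end idempotents. -/

section Primary

variable {B : Type*} [Ring B] [Algebra ℂ B] {d : ℕ} {e es : ℕ → B}

/-- The element `2^d ∑_i k_i⁻¹ e_i^* e_0 e_i^*`. -/
def primaryIdem (d : ℕ) (e es : ℕ → B) : B :=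
  (2 : ℂ) ^ d • ∑ i ∈ Finset.range (d + 1), (d.choose i : ℂ)⁻¹ • (es i * e 0 * es i)

namespace IsCubePair

variable (p : IsCubePair d e es)
include p

lemma zero_krawSum_zero (i : ℕ) : es 0 * krawSum d e i * es 0 = if i = 0 then es 0 else 0 := by
  split_ifs with hi
  · rw [hi, p.left.krawSum_zero, mul_one, p.right.mul_self]
  · exact p.triple_eq_zero_of_lt i 0 0 (by omega)

lemma zero_idem_zero {i : ℕ} (hi : i ≤ d) :
    es 0 * e i * es 0 = (((2 : ℂ) ^ d)⁻¹ * d.choose i) • es 0 := by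
  rw [IsIdempotentSystem.idem_eq_sum e hi]
  simp only [mul_smul_comm, smul_mul_assoc, Finset.mul_sum, Finset.sum_mul, p.zero_krawSum_zero]
  simp [kraw_zero_right, smul_smul]

lemma idem_krawSum_zero (i j : ℕ) :
    es i * krawSum d e j * es 0 = if i = j then krawSum d e j * es 0 else 0 := by
  have h (i j : ℕ) (hij : i ≠ j) : es i * krawSum d e j * es 0 = 0 := by
    rcases lt_or_gt_of_ne hij with hlt | hlt
    · exact p.triple_eq_zero_of_lt j i 0 (by omega)
    · exact p.triple_eq_zero_of_add_right_lt j i 0 (by omega)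
  split_ifs with hij
  · subst hij
    rcases le_or_gt i d with hi | hi
    · conv_rhs => rw [← p.right.sum_mul (krawSum d e i * es 0)]
      rw [Finset.sum_eq_single_of_mem i (by simp; omega), mul_assoc]
      intro k _ hk
      rw [← mul_assoc, h k i hk]
    · rw [IsIdempotentSystem.krawSum_eq_zero e hi, mul_zero]
  · exact h i j hij

lemma zero_krawSum_idem (i j : ℕ) :
    es 0 * krawSum d e j * es i = if i = j then es 0 * krawSum d e j else 0 := by
  have h (i j : ℕ) (hij : i ≠ j) : es 0 * krawSum d e j * es i = 0 := by
    rcases lt_or_gt_of_ne hij with hlt | hlt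
    · exact p.triple_eq_zero_of_lt j 0 i (by omega)
    · exact p.triple_eq_zero_of_add_left_lt j 0 i (by omega)
  split_ifs with hij
  · subst hij
    rcases le_or_gt i d with hi | hi
    · conv_rhs => rw [← p.right.mul_sum (es 0 * krawSum d e i)]
      rw [Finset.sum_eq_single_of_mem i (by simp; omega)]
      intro k _ hk
      rw [h k i hk]
    · rw [IsIdempotentSystem.krawSum_eq_zero e hi, mul_zero, zero_mul]
  · exact h i j hij

lemma krawSum_zero_eq {i : ℕ} (hi : i ≤ d) :
    krawSum d e i * es 0 = (2 : ℂ) ^ d • (es i * e 0 * es 0) := by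
  rw [IsIdempotentSystem.idem_eq_sum e (Nat.zero_le d)]
  simp only [mul_smul_comm, smul_mul_assoc, Finset.mul_sum, Finset.sum_mul, p.idem_krawSum_zero,
    smul_inv_smul₀ (two_pow_ne_zero d)]
  simp [kraw_zero_left, hi]

lemma zero_krawSum_eq {i : ℕ} (hi : i ≤ d) :
    es 0 * krawSum d e i = (2 : ℂ) ^ d • (es 0 * e 0 * es i) := by
  rw [IsIdempotentSystem.idem_eq_sum e (Nat.zero_le d)]
  simp only [mul_smul_comm, smul_mul_assoc, Finset.mul_sum, Finset.sum_mul, p.zero_krawSum_idem,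
    smul_inv_smul₀ (two_pow_ne_zero d)]
  simp [kraw_zero_left, hi]

lemma idem_mul_primaryIdem (j : ℕ) : es j * primaryIdem d e es = primaryIdem d e es * es j := by
  simp only [primaryIdem, mul_smul_comm, smul_mul_assoc, Finset.mul_sum, Finset.sum_mul]
  congr 1
  refine Finset.sum_congr rfl fun i _ => ?_
  by_cases hij : i = j
  · subst hij
    rw [← mul_assoc, ← mul_assoc, p.right.mul_self, mul_assoc _ (es i), p.right.mul_self]
  · rw [← mul_assoc, ← mul_assoc, p.right.mul_ne (Ne.symm hij), mul_assoc _ (es i),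
      p.right.mul_ne hij, zero_mul, zero_mul, mul_zero]

lemma primaryIdem_mul_zero : primaryIdem d e es * e 0 = e 0 := by
  rw [primaryIdem, smul_mul_assoc, Finset.sum_mul, Finset.smul_sum]
  conv_rhs => rw [← p.right.sum_mul (e 0)]
  refine Finset.sum_congr rfl fun i hi => ?_
  have hi := Nat.lt_succ_iff.mp (Finset.mem_range.mp hi)
  have hc : (d.choose i : ℂ) ≠ 0 := by exact_mod_cast (Nat.choose_pos hi).ne'
  have h2 := two_pow_ne_zero d
  rw [smul_mul_assoc, mul_assoc, mul_assoc, ← mul_assoc (e 0), p.symm.zero_idem_zero hi,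
    mul_smul_comm, smul_smul, smul_smul]
  convert one_smul ℂ (es i * e 0) using 2
  field_simp

lemma zero_mul_primaryIdem : e 0 * primaryIdem d e es = e 0 := by
  rw [primaryIdem, mul_smul_comm, Finset.mul_sum, Finset.smul_sum]
  conv_rhs => rw [← p.right.mul_sum (e 0)]
  refine Finset.sum_congr rfl fun i hi => ?_
  have hi := Nat.lt_succ_iff.mp (Finset.mem_range.mp hi)
  have hc : (d.choose i : ℂ) ≠ 0 := by exact_mod_cast (Nat.choose_pos hi).ne'
  have h2 := two_pow_ne_zero d
  rw [mul_smul_comm, ← mul_assoc, ← mul_assoc, p.symm.zero_idem_zero hi,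
    smul_mul_assoc, smul_smul, smul_smul]
  convert one_smul ℂ (e 0 * es i) using 2
  field_simp

/-- `e i * es 0` is a combination of the elements `es j * e 0 * es 0`; u_0 commutes past `es j` and
fixes `e 0`. -/
lemma primaryIdem_mul_idem_mul_zero {i : ℕ} (hi : i ≤ d) :
    primaryIdem d e es * (e i * es 0) = e i * es 0 := by
  rw [IsIdempotentSystem.idem_eq_sum e hi, smul_mul_assoc, mul_smul_comm, Finset.sum_mul,
    Finset.mul_sum]
  congr 1
  refine Finset.sum_congr rfl fun j hj => ?_
  rw [smul_mul_assoc, mul_smul_comm,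
    p.krawSum_zero_eq (Nat.lt_succ_iff.mp (Finset.mem_range.mp hj)), mul_smul_comm, mul_assoc,
    ← mul_assoc _ (es j), ← p.idem_mul_primaryIdem, mul_assoc, ← mul_assoc _ (e 0),
    p.primaryIdem_mul_zero]

lemma zero_mul_idem_mul_primaryIdem {i : ℕ} (hi : i ≤ d) :
    es 0 * e i * primaryIdem d e es = es 0 * e i := by
  rw [IsIdempotentSystem.idem_eq_sum e hi, mul_smul_comm, smul_mul_assoc, Finset.mul_sum,
    Finset.sum_mul]
  congr 1
  refine Finset.sum_congr rfl fun j hj => ?_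
  rw [mul_smul_comm, smul_mul_assoc,
    p.zero_krawSum_eq (Nat.lt_succ_iff.mp (Finset.mem_range.mp hj)), smul_mul_assoc, mul_assoc,
    p.idem_mul_primaryIdem, ← mul_assoc, mul_assoc (es 0), p.zero_mul_primaryIdem]

lemma primaryIdem_mul_dual : primaryIdem d e es * primaryIdem d es e = primaryIdem d es e := by
  conv_lhs => rw [primaryIdem.eq_1 d es e, mul_smul_comm, Finset.mul_sum]
  rw [primaryIdem.eq_1 d es e]
  congr 1
  refine Finset.sum_congr rfl fun i hi => ?_
  rw [mul_smul_comm, ← mul_assoc,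
    p.primaryIdem_mul_idem_mul_zero (Nat.lt_succ_iff.mp (Finset.mem_range.mp hi))]

lemma primaryIdem_mul_dual' : primaryIdem d e es * primaryIdem d es e = primaryIdem d e es := by
  conv_lhs => rw [primaryIdem.eq_1 d e es, smul_mul_assoc, Finset.sum_mul]
  rw [primaryIdem.eq_1 d e es]
  congr 1
  refine Finset.sum_congr rfl fun i hi => ?_
  rw [smul_mul_assoc, mul_assoc (es i), mul_assoc (es i),
    p.symm.zero_mul_idem_mul_primaryIdem (Nat.lt_succ_iff.mp (Finset.mem_range.mp hi))]

/-- Each summand of the dual element begins with some `e i * es 0`, which u_0 fixes on the left;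
symmetrically, the dual element fixes the summands of u_0 on the right. The product of the two
therefore equals each of them. -/
lemma primaryIdem_dual : primaryIdem d es e = primaryIdem d e es :=
  p.primaryIdem_mul_dual.symm.trans p.primaryIdem_mul_dual'

lemma isIdempotentElem_primaryIdem : IsIdempotentElem (primaryIdem d e es) := by
  have h := p.primaryIdem_mul_dual'
  rwa [p.primaryIdem_dual] at h

lemma left_mul_primaryIdem (j : ℕ) : e j * primaryIdem d e es = primaryIdem d e es * e j := by
  rw [← p.primaryIdem_dual]
  exact p.symm.idem_mul_primaryIdem j

lemma krawSum_top_mul_self : krawSum d e d * krawSum d e d = 1 :=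
  p.left.ext_right fun i hi => by
    rw [mul_assoc, p.left.krawSum_mul_idem, mul_smul_comm, p.left.krawSum_mul_idem, smul_smul,
      kraw_top_mul_self hi, one_smul, one_mul]

/-- `krawSum d e d` is the antipodal involution, exchanging `es 0` and `es d`. As it commutes with
u_0, the fact that u_0 fixes `es 0` carries over to `es d`. -/
lemma top_eq : es d = krawSum d e d * es 0 * krawSum d e d := by
  have h1 : krawSum d e d * es 0 = es d * krawSum d e d * es 0 := by
    rw [p.idem_krawSum_zero, if_pos rfl]
  have h2 : es d * krawSum d e d = es d * krawSum d e d * es 0 := by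
    conv_lhs => rw [← p.right.mul_sum (es d * krawSum d e d)]
    refine Finset.sum_eq_single_of_mem 0 (by simp) fun k _ hk => ?_
    exact p.triple_eq_zero_of_two_mul_lt d d k (by omega)
  rw [h1, ← h2, mul_assoc, p.krawSum_top_mul_self, mul_one]

lemma right_zero_mul_primaryIdem : es 0 * primaryIdem d e es = es 0 := by
  rw [← p.primaryIdem_dual]
  exact p.symm.zero_mul_primaryIdem

lemma top_mul_primaryIdem : es d * primaryIdem d e es = es d := by
  have h : krawSum d e d * primaryIdem d e es = primaryIdem d e es * krawSum d e d := by
    simp only [krawSum, Finset.sum_mul, Finset.mul_sum, smul_mul_assoc, mul_smul_comm,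
      p.left_mul_primaryIdem]
  rw [p.top_eq, mul_assoc, h, ← mul_assoc, mul_assoc _ (es 0), p.right_zero_mul_primaryIdem]

lemma left_top_mul_primaryIdem : e d * primaryIdem d e es = e d := by
  rw [← p.primaryIdem_dual]
  exact p.symm.top_mul_primaryIdem

end IsCubePair

end Primary

/-! ### 𝒯_d as the universal algebra carrying a cube pair. -/

section Presentation

variable {B : Type*} [Ring B] [Algebra ℂ B] {d : ℕ}

/-- The product relations give `x a * e i = K_a(i) e i`, after which Krawtchouk orthogonality yields
orthogonal idempotents. -/
lemma isIdempotentSystem_of_mul_eq {x e : ℕ → B} (h0 : x 0 = 1)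
    (hx : ∀ i ≤ d, ∀ j ≤ d,
      x i * x j = ∑ h ∈ Finset.range (d + 1), (cubeP d h i j : ℂ) • x h)
    (he : ∀ i ≤ d, e i = ((2 : ℂ) ^ d)⁻¹ • krawSum d x i) (he' : ∀ i, d < i → e i = 0) :
    IsIdempotentSystem d e ∧ ∀ i ≤ d, krawSum d e i = x i := by
  have hxe (i : ℕ) (hi : i ≤ d) : krawSum d e i = x i := by
    rw [IsIdempotentSystem.idem_eq_sum x hi, krawSum, Finset.smul_sum]
    refine Finset.sum_congr rfl fun j hj => ?_
    rw [he j (Nat.lt_succ_iff.mp (Finset.mem_range.mp hj)), smul_comm]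
  have hmul (a i : ℕ) (ha : a ≤ d) (hi : i ≤ d) : x a * e i = kraw d a i • e i := by
    rw [he i hi, mul_smul_comm, smul_comm (kraw d a i), krawSum, Finset.mul_sum]
    congr 1
    rw [Finset.smul_sum]
    have h (b : ℕ) (hb : b ∈ Finset.range (d + 1)) : x a * kraw d i b • x b =
        ∑ c ∈ Finset.range (d + 1), ((cubeP d c a b : ℂ) * kraw d i b) • x c := by
      rw [mul_smul_comm, hx a ha b (Nat.lt_succ_iff.mp (Finset.mem_range.mp hb)), Finset.smul_sum]
      exact Finset.sum_congr rfl fun c _ => by rw [smul_smul, mul_comm]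
    rw [Finset.sum_congr rfl h, Finset.sum_comm]
    refine Finset.sum_congr rfl fun c hc => ?_
    rw [← Finset.sum_smul,
      sum_cubeP_mul_kraw (Nat.lt_succ_iff.mp (Finset.mem_range.mp hc)) ha hi, smul_smul]
  refine ⟨⟨fun j i => ?_, ?_⟩, hxe⟩
  · rcases lt_or_ge d j with hj | hj
    · rw [he' j hj, zero_mul, ite_self]
    rcases lt_or_ge d i with hi | hi
    · rw [he' i hi, mul_zero, if_neg (by omega)]
    have h : ∑ a ∈ Finset.range (d + 1), kraw d j a • x a * e i =
        (if j = i then (2 : ℂ) ^ d else 0) • e i := by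
      rw [← sum_kraw_mul_kraw hj hi, Finset.sum_smul]
      refine Finset.sum_congr rfl fun a ha => ?_
      rw [smul_mul_assoc, hmul a i (Nat.lt_succ_iff.mp (Finset.mem_range.mp ha)) hi, smul_smul]
    rw [he j hj, smul_mul_assoc, krawSum, Finset.sum_mul, h, ← krawSum, ← he j hj]
    split_ifs with hij
    · rw [hij, inv_smul_smul₀ (two_pow_ne_zero d)]
    · rw [zero_smul, smul_zero]
  · rw [← h0, ← hxe 0 (Nat.zero_le d), krawSum]
    exact Finset.sum_congr rfl fun i _ => by rw [kraw_zero_left, one_smul]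

/-- The generator `x_i` of `𝒯_d`. -/
def cubeX (d i : ℕ) : CubeT d :=
  RingQuot.mkAlgHom ℂ (hypercube d).TerwilligerRel ((hypercube d).freeX i)

/-- The generator `x_i^*` of `𝒯_d`. -/
def cubeXs (d i : ℕ) : CubeT d :=
  RingQuot.mkAlgHom ℂ (hypercube d).TerwilligerRel ((hypercube d).freeXs i)

lemma range_hypercube_diam (d : ℕ) :
    Finset.range ((hypercube d).diam + 1) = Finset.range (d + 1) := by
  rw [hypercube_diam]

lemma freeE_eq {i : ℕ} (hi : i ≤ d) : (hypercube d).freeE i =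
    ((2 : ℂ) ^ d)⁻¹ • ∑ j ∈ Finset.range (d + 1), kraw d i j • (hypercube d).freeX j := by
  rw [SimpleGraph.freeE, if_pos (by simpa), card_cube, range_hypercube_diam]
  congr 1
  exact Finset.sum_congr rfl fun j hj => by
    rw [hypercube_qCoeff hi (Nat.lt_succ_iff.mp (Finset.mem_range.mp hj))]

lemma freeEs_eq {i : ℕ} (hi : i ≤ d) : (hypercube d).freeEs i =
    ((2 : ℂ) ^ d)⁻¹ • ∑ j ∈ Finset.range (d + 1), kraw d i j • (hypercube d).freeXs j := by
  rw [SimpleGraph.freeEs, if_pos (by simpa), card_cube, range_hypercube_diam]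
  congr 1
  exact Finset.sum_congr rfl fun j hj => by
    rw [hypercube_dualQCoeff hi (Nat.lt_succ_iff.mp (Finset.mem_range.mp hj))]

lemma freeE_eq_zero {i : ℕ} (hi : d < i) : (hypercube d).freeE i = 0 := by
  rw [SimpleGraph.freeE, if_neg (by simpa)]

lemma freeEs_eq_zero {i : ℕ} (hi : d < i) : (hypercube d).freeEs i = 0 := by
  rw [SimpleGraph.freeEs, if_neg (by simpa)]

lemma cubeE_system : IsIdempotentSystem d (cubeE d) ∧
    ∀ i ≤ d, krawSum d (cubeE d) i = cubeX d i := by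
  refine isIdempotentSystem_of_mul_eq ?_ (fun i hi j hj => ?_) (fun i hi => ?_) fun i hi => ?_
  · rw [cubeX, RingQuot.mkAlgHom_rel ℂ .T1, map_one]
  · rw [cubeX, cubeX, ← map_mul, RingQuot.mkAlgHom_rel ℂ (.T2 i j (by simpa) (by simpa)), map_sum,
      range_hypercube_diam]
    refine Finset.sum_congr rfl fun h hh => ?_
    rw [map_smul, hypercube_intersectionNumber (Nat.lt_succ_iff.mp (Finset.mem_range.mp hh)) hi hj]
    rfl
  · rw [cubeE, SimpleGraph.genE, freeE_eq hi]
    simp only [map_smul, map_sum]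
    rfl
  · rw [cubeE, SimpleGraph.genE, freeE_eq_zero hi, map_zero]

lemma cubeEs_system : IsIdempotentSystem d (cubeEs d) ∧
    ∀ i ≤ d, krawSum d (cubeEs d) i = cubeXs d i := by
  refine isIdempotentSystem_of_mul_eq ?_ (fun i hi j hj => ?_) (fun i hi => ?_) fun i hi => ?_
  · rw [cubeXs, RingQuot.mkAlgHom_rel ℂ .T1s, map_one]
  · rw [cubeXs, cubeXs, ← map_mul, RingQuot.mkAlgHom_rel ℂ (.T2s i j (by simpa) (by simpa)),
      map_sum, range_hypercube_diam]
    refine Finset.sum_congr rfl fun h hh => ?_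
    rw [map_smul, hypercube_kreinParameter (Nat.lt_succ_iff.mp (Finset.mem_range.mp hh)) hi hj]
    rfl
  · rw [cubeEs, SimpleGraph.genEs, freeEs_eq hi]
    simp only [map_smul, map_sum]
    rfl
  · rw [cubeEs, SimpleGraph.genEs, freeEs_eq_zero hi, map_zero]

lemma cubeP_one_eq_zero {h k : ℕ} (h1 : h ≠ k + 1) (h2 : k ≠ h + 1) : cubeP d h 1 k = 0 := by
  rw [cubeP_eq_zero_iff]
  rintro ⟨a, b, _, _, _, _⟩
  omega

lemma isCubePair_cubeT (d : ℕ) : IsCubePair d (cubeE d) (cubeEs d) where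
  left := cubeE_system.1
  right := cubeEs_system.1
  tri h k h1 h2 := by
    rcases lt_or_ge d h with hh | hh
    · rw [cubeEs_system.1.eq_zero hh, zero_mul, zero_mul]
    rcases lt_or_ge d k with hk | hk
    · rw [cubeEs_system.1.eq_zero hk, mul_zero]
    -- For `d = 0` the index 1 exceeds the diameter, so no defining relation applies, but `krawSum`
    -- itself vanishes.
    rcases d.eq_zero_or_pos with hd | hd
    · rw [IsIdempotentSystem.krawSum_eq_zero _ (by omega), mul_zero, zero_mul]
    have hp : (hypercube d).intersectionNumber h 1 k = 0 := by
      rw [hypercube_intersectionNumber hh hd hk, cubeP_one_eq_zero h1 h2]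
    rw [cubeE_system.2 1 hd, cubeX, cubeEs, cubeEs, SimpleGraph.genEs, SimpleGraph.genEs,
      ← map_mul, ← map_mul, RingQuot.mkAlgHom_rel ℂ
        (.T3 h 1 k (by simpa) (by rwa [hypercube_diam]) (by simpa) hp), map_zero]
  tri_dual h k h1 h2 := by
    rcases lt_or_ge d h with hh | hh
    · rw [cubeE_system.1.eq_zero hh, zero_mul, zero_mul]
    rcases lt_or_ge d k with hk | hk
    · rw [cubeE_system.1.eq_zero hk, mul_zero]
    rcases d.eq_zero_or_pos with hd | hd
    · rw [IsIdempotentSystem.krawSum_eq_zero _ (by omega), mul_zero, zero_mul]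
    have hp : (hypercube d).kreinParameter h 1 k = 0 := by
      rw [hypercube_kreinParameter hh hd hk, cubeP_one_eq_zero h1 h2, Nat.cast_zero]
    rw [cubeEs_system.2 1 hd, cubeXs, cubeE, cubeE, SimpleGraph.genE, SimpleGraph.genE,
      ← map_mul, ← map_mul, RingQuot.mkAlgHom_rel ℂ
        (.T3s h 1 k (by simpa) (by rwa [hypercube_diam]) (by simpa) hp), map_zero]

lemma cubeT_subalgebra_eq_top {S : Subalgebra ℂ (CubeT d)} (h : ∀ i, cubeE d i ∈ S)
    (hs : ∀ i, cubeEs d i ∈ S) : S = ⊤ := by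
  have hX (i : ℕ) (hi : i ≤ d) : cubeX d i ∈ S := by
    rw [← cubeE_system.2 i hi]
    exact S.sum_mem fun j _ => S.smul_mem (h j) _
  have hXs (i : ℕ) (hi : i ≤ d) : cubeXs d i ∈ S := by
    rw [← cubeEs_system.2 i hi]
    exact S.sum_mem fun j _ => S.smul_mem (hs j) _
  rw [eq_top_iff]
  rintro a -
  obtain ⟨w, rfl⟩ := RingQuot.mkAlgHom_surjective ℂ (hypercube d).TerwilligerRel a
  induction w using FreeAlgebra.induction with
  | grade0 r => rw [AlgHom.commutes]; exact S.algebraMap_mem r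
  | grade1 g =>
    rcases g with i | i
    · have := hX i (by simpa using Nat.lt_succ_iff.mp i.2)
      rwa [cubeX, SimpleGraph.freeX, dif_pos i.2] at this
    · have := hXs i (by simpa using Nat.lt_succ_iff.mp i.2)
      rwa [cubeXs, SimpleGraph.freeXs, dif_pos i.2] at this
  | mul a b ha hb => rw [map_mul]; exact S.mul_mem ha hb
  | add a b ha hb => rw [map_add]; exact S.add_mem ha hb

lemma IsCubePair.exists_algHom {e es : ℕ → B} (p : IsCubePair d e es) :
    ∃ f : CubeT d →ₐ[ℂ] B, (∀ i, f (cubeE d i) = e i) ∧ ∀ i, f (cubeEs d i) = es i := by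
  set F : (hypercube d).TerwilligerFree →ₐ[ℂ] B := FreeAlgebra.lift ℂ
    (Sum.elim (fun i => krawSum d e i) fun i => krawSum d es i) with hF
  have hX (i : ℕ) : F ((hypercube d).freeX i) = krawSum d e i := by
    rw [SimpleGraph.freeX]
    split_ifs with hi
    · rw [hF, FreeAlgebra.lift_ι_apply, Sum.elim_inl]
    · rw [hypercube_diam] at hi
      rw [map_zero, IsIdempotentSystem.krawSum_eq_zero e (by omega)]
  have hXs (i : ℕ) : F ((hypercube d).freeXs i) = krawSum d es i := by
    rw [SimpleGraph.freeXs]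
    split_ifs with hi
    · rw [hF, FreeAlgebra.lift_ι_apply, Sum.elim_inr]
    · rw [hypercube_diam] at hi
      rw [map_zero, IsIdempotentSystem.krawSum_eq_zero es (by omega)]
  have hE (i : ℕ) : F ((hypercube d).freeE i) = e i := by
    rcases lt_or_ge d i with hi | hi
    · rw [freeE_eq_zero hi, map_zero, p.left.eq_zero hi]
    · rw [freeE_eq hi]
      simp only [map_smul, map_sum, hX]
      exact (IsIdempotentSystem.idem_eq_sum e hi).symm
  have hEs (i : ℕ) : F ((hypercube d).freeEs i) = es i := by
    rcases lt_or_ge d i with hi | hi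
    · rw [freeEs_eq_zero hi, map_zero, p.right.eq_zero hi]
    · rw [freeEs_eq hi]
      simp only [map_smul, map_sum, hXs]
      exact (IsIdempotentSystem.idem_eq_sum es hi).symm
  have hrel : ∀ ⦃a b⦄, (hypercube d).TerwilligerRel a b → F a = F b := by
    intro a b h
    induction h with
    | T1 => rw [hX, p.left.krawSum_zero, map_one]
    | T1s => rw [hXs, p.right.krawSum_zero, map_one]
    | T2 i j hi hj =>
      rw [hypercube_diam] at hi hj
      rw [map_mul, hX, hX, p.left.krawSum_mul_krawSum hi hj, map_sum,
        range_hypercube_diam]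
      refine Finset.sum_congr rfl fun h hh => ?_
      rw [map_smul, hX,
        hypercube_intersectionNumber (Nat.lt_succ_iff.mp (Finset.mem_range.mp hh)) hi hj]
    | T2s i j hi hj =>
      rw [hypercube_diam] at hi hj
      rw [map_mul, hXs, hXs, p.right.krawSum_mul_krawSum hi hj, map_sum,
        range_hypercube_diam]
      refine Finset.sum_congr rfl fun h hh => ?_
      rw [map_smul, hXs,
        hypercube_kreinParameter (Nat.lt_succ_iff.mp (Finset.mem_range.mp hh)) hi hj]
    | T3 h i j hh hi hj hp =>
      rw [hypercube_diam] at hh hi hj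
      rw [hypercube_intersectionNumber hh hi hj] at hp
      rw [map_mul, map_mul, hEs, hEs, hX, p.triple_eq_zero hp, map_zero]
    | T3s h i j hh hi hj hp =>
      rw [hypercube_diam] at hh hi hj
      rw [hypercube_kreinParameter hh hi hj, Nat.cast_eq_zero] at hp
      rw [map_mul, map_mul, hE, hE, hXs, p.symm.triple_eq_zero hp, map_zero]
  refine ⟨RingQuot.liftAlgHom ℂ ⟨F, hrel⟩, fun i => ?_, fun i => ?_⟩
  · rw [cubeE, SimpleGraph.genE, RingQuot.liftAlgHom_mkAlgHom_apply, hE]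
  · rw [cubeEs, SimpleGraph.genEs, RingQuot.liftAlgHom_mkAlgHom_apply, hEs]

lemma cubeT_algHom_ext {f g : CubeT d →ₐ[ℂ] B} (h : ∀ i, f (cubeE d i) = g (cubeE d i))
    (hs : ∀ i, f (cubeEs d i) = g (cubeEs d i)) : f = g := by
  have := cubeT_subalgebra_eq_top (S := AlgHom.equalizer f g) h hs
  exact AlgHom.ext fun a => (this ▸ Algebra.mem_top : a ∈ AlgHom.equalizer f g)

lemma cubeU_eq (d : ℕ) : cubeU d = primaryIdem d (cubeE d) (cubeEs d) := by
  rw [cubeU, primaryIdem]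
  congr 1
  refine Finset.sum_congr rfl fun i hi => ?_
  have hi := Nat.lt_succ_iff.mp (Finset.mem_range.mp hi)
  rw [SimpleGraph.valency, hypercube_intersectionNumber (Nat.zero_le d) hi hi, cubeP_zero_self hi]

lemma cubeUDual_eq (d : ℕ) : cubeUDual d = primaryIdem d (cubeEs d) (cubeE d) := by
  rw [cubeUDual, primaryIdem]
  congr 1
  refine Finset.sum_congr rfl fun i hi => ?_
  have hi := Nat.lt_succ_iff.mp (Finset.mem_range.mp hi)
  rw [SimpleGraph.dualValency, hypercube_kreinParameter (Nat.zero_le d) hi hi, cubeP_zero_self hi]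

lemma cubeU_mem_center (d : ℕ) : cubeU d ∈ Subalgebra.center ℂ (CubeT d) := by
  have h := cubeT_subalgebra_eq_top (S := Subalgebra.centralizer ℂ {cubeU d})
    (fun i => Subalgebra.mem_centralizer_iff ℂ |>.mpr fun g hg => ?_)
    (fun i => Subalgebra.mem_centralizer_iff ℂ |>.mpr fun g hg => ?_)
  · rw [Subalgebra.mem_center_iff]
    intro b
    have hb : b ∈ Subalgebra.centralizer ℂ {cubeU d} := h ▸ Algebra.mem_top
    exact (Subalgebra.mem_centralizer_iff ℂ |>.mp hb _ rfl).symm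
  · rw [Set.mem_singleton_iff.mp hg, cubeU_eq, (isCubePair_cubeT d).left_mul_primaryIdem]
  · rw [Set.mem_singleton_iff.mp hg, cubeU_eq, (isCubePair_cubeT d).idem_mul_primaryIdem]

end Presentation

/-! ### Shifting indices between diameters `n` and `n + 2`, and the quotient by u_0. -/

section Reduction

variable {B C : Type*} [Ring B] [Ring C] {d n : ℕ} {e es : ℕ → B}

/-- The sequence `0, e 0, e 1, …`. -/
def shiftUp (e : ℕ → B) : ℕ → B
  | 0 => 0
  | i + 1 => e i

lemma IsIdempotentSystem.shiftUp (s : IsIdempotentSystem n e) :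
    IsIdempotentSystem (n + 2) (shiftUp e) where
  mul_eq i j := by
    cases i <;> cases j <;> simp [_root_.shiftUp, s.mul_eq]
  sum_eq := by
    rw [Finset.sum_range_succ', Finset.sum_range_succ]
    simp [_root_.shiftUp, s.sum_eq, s.eq_zero (Nat.lt_succ_self n)]

lemma IsIdempotentSystem.shiftDown (s : IsIdempotentSystem (n + 2) e) (h0 : e 0 = 0)
    (hn : e (n + 2) = 0) : IsIdempotentSystem n fun i => e (i + 1) where
  mul_eq i j := by simp [s.mul_eq]
  sum_eq := by
    have := s.sum_eq
    rwa [Finset.sum_range_succ', Finset.sum_range_succ, h0, hn, add_zero, add_zero] at this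

lemma shiftUp_shiftDown (h0 : e 0 = 0) : shiftUp (fun i => e (i + 1)) = e := by
  funext i
  cases i <;> simp [shiftUp, h0]

/-- The congruence `a w = b w` attached to a central idempotent `w`. -/
def centralIdempotentCon {w : B} (hc : ∀ a, w * a = a * w) (hw : w * w = w) : RingCon B where
  r a b := a * w = b * w
  iseqv := ⟨fun _ => rfl, Eq.symm, Eq.trans⟩
  mul' {a b c d} (hab : a * w = b * w) (hcd : c * w = d * w) := by
    have h (x y : B) : x * y * w = (x * w) * (y * w) := by
      rw [mul_assoc x w, ← mul_assoc w, hc y, mul_assoc y, hw, mul_assoc]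
    change a * c * w = b * d * w
    rw [h, h, hab, hcd]
  add' {a b c d} (hab : a * w = b * w) (hcd : c * w = d * w) := by
    rw [add_mul, add_mul, hab, hcd]

variable [Algebra ℂ B] [Algebra ℂ C]

lemma map_krawSum (f : B →ₐ[ℂ] C) (i : ℕ) :
    f (krawSum d e i) = krawSum d (fun j => f (e j)) i := by
  simp only [krawSum, map_sum, map_smul]

lemma IsIdempotentSystem.map (s : IsIdempotentSystem d e) (f : B →ₐ[ℂ] C) :
    IsIdempotentSystem d fun i => f (e i) where
  mul_eq i j := by rw [← map_mul, s.mul_eq, apply_ite f, map_zero]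
  sum_eq := by rw [← map_sum, s.sum_eq, map_one]

lemma IsCubePair.map (p : IsCubePair d e es) (f : B →ₐ[ℂ] C) :
    IsCubePair d (fun i => f (e i)) fun i => f (es i) where
  left := p.left.map f
  right := p.right.map f
  tri h k h1 h2 := by rw [← map_krawSum, ← map_mul, ← map_mul, p.tri h k h1 h2, map_zero]
  tri_dual h k h1 h2 := by
    rw [← map_krawSum, ← map_mul, ← map_mul, p.tri_dual h k h1 h2, map_zero]

lemma map_primaryIdem (f : B →ₐ[ℂ] C) : f (primaryIdem d e es) =
    primaryIdem d (fun i => f (e i)) fun i => f (es i) := by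
  simp only [primaryIdem, map_sum, map_smul, map_mul]

/-- The eigenvalue `(n + 2) - 2(i + 1)` at the shifted index equals `n - 2i`, so tridiagonality is
unaffected by padding. -/
lemma IsIdempotentSystem.krawSum_shiftUp (s : IsIdempotentSystem n e) :
    krawSum (n + 2) (_root_.shiftUp e) 1 = krawSum n e 1 := by
  refine s.ext_right fun i _ => ?_
  rw [s.krawSum_one_mul_idem]
  refine (s.shiftUp.krawSum_one_mul_idem (j := i + 1)).trans ?_
  change _ • e i = _
  congr 1
  push_cast
  ring

lemma IsCubePair.shiftUp (p : IsCubePair n e es) :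
    IsCubePair (n + 2) (shiftUp e) (shiftUp es) where
  left := p.left.shiftUp
  right := p.right.shiftUp
  tri h k h1 h2 := by
    rw [p.left.krawSum_shiftUp]
    cases h <;> cases k <;> simp only [_root_.shiftUp, zero_mul, mul_zero]
    exact p.tri _ _ (by omega) (by omega)
  tri_dual h k h1 h2 := by
    rw [p.right.krawSum_shiftUp]
    cases h <;> cases k <;> simp only [_root_.shiftUp, zero_mul, mul_zero]
    exact p.tri_dual _ _ (by omega) (by omega)

lemma IsCubePair.shiftDown (p : IsCubePair (n + 2) e es) (h0 : e 0 = 0) (hn : e (n + 2) = 0)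
    (hs0 : es 0 = 0) (hsn : es (n + 2) = 0) :
    IsCubePair n (fun i => e (i + 1)) fun i => es (i + 1) where
  left := p.left.shiftDown h0 hn
  right := p.right.shiftDown hs0 hsn
  tri h k h1 h2 := by
    rw [← (p.left.shiftDown h0 hn).krawSum_shiftUp, shiftUp_shiftDown h0]
    exact p.tri _ _ (by omega) (by omega)
  tri_dual h k h1 h2 := by
    rw [← (p.right.shiftDown hs0 hsn).krawSum_shiftUp, shiftUp_shiftDown hs0]
    exact p.tri_dual _ _ (by omega) (by omega)

/-- Supplies a unital model of `B w`, so that unital algebra homomorphisms and the universal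
property of 𝒯_n can be used. -/
lemma exists_algHom_eq_iff_mul_eq.{u} {B : Type u} [Ring B] [Algebra ℂ B] {w : B}
    (hc : ∀ a, w * a = a * w) (hw : w * w = w) :
    ∃ (C : Type u) (_ : Ring C) (_ : Algebra ℂ C) (q : B →ₐ[ℂ] C),
      ∀ a b, q a = q b ↔ a * w = b * w :=
  ⟨(centralIdempotentCon hc hw).Quotient, inferInstance, inferInstance,
    { (centralIdempotentCon hc hw).mk' with commutes' := fun _ => rfl },
    fun _ _ => RingCon.eq _⟩

/-- The kernel of the reduction homomorphism `𝒯_{n+2} → 𝒯_n` is `𝒯_{n+2} u_0`. -/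
lemma exists_reduction (n : ℕ) : ∃ f : CubeT (n + 2) →ₐ[ℂ] CubeT n,
    (∀ i, f (cubeE (n + 2) i) = shiftUp (cubeE n) i) ∧
    (∀ i, f (cubeEs (n + 2) i) = shiftUp (cubeEs n) i) ∧
    Function.Surjective f ∧ f (cubeU (n + 2)) = 0 ∧
    ∀ a b, f a = f b → a * (1 - cubeU (n + 2)) = b * (1 - cubeU (n + 2)) := by
  obtain ⟨f, hf, hfs⟩ := (isCubePair_cubeT n).shiftUp.exists_algHom
  have p := isCubePair_cubeT (n + 2)
  have hu : f (cubeU (n + 2)) = 0 := by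
    rw [cubeU_eq, map_primaryIdem, primaryIdem]
    simp [hf, shiftUp]
  refine ⟨f, hf, hfs, ?_, hu, ?_⟩
  · rw [← AlgHom.range_eq_top]
    exact cubeT_subalgebra_eq_top (fun i => ⟨cubeE (n + 2) (i + 1), hf _⟩)
      fun i => ⟨cubeEs (n + 2) (i + 1), hfs _⟩
  · have hc := Subalgebra.mem_center_iff.mp (cubeU_mem_center (n + 2))
    have hi : IsIdempotentElem (cubeU (n + 2)) := cubeU_eq (n + 2) ▸ p.isIdempotentElem_primaryIdem
    obtain ⟨C, _, _, q, hq⟩ := exists_algHom_eq_iff_mul_eq (w := 1 - cubeU (n + 2))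
      (fun a => by rw [sub_mul, mul_sub, one_mul, mul_one, hc]) hi.one_sub
    have hz {x : CubeT (n + 2)}
        (hx : x * primaryIdem (n + 2) (cubeE (n + 2)) (cubeEs (n + 2)) = x) :
        q x = 0 := by
      rw [← map_zero q, hq, cubeU_eq, mul_sub, hx, mul_one, sub_self, zero_mul]
    have h0 := hz p.zero_mul_primaryIdem
    have hs0 := hz p.right_zero_mul_primaryIdem
    -- The four end idempotents are fixed by u_0, hence vanish under `q`; the images under `q`
    -- therefore shift down to a pair of diameter `n`.
    obtain ⟨g, hg, hgs⟩ := ((p.map q).shiftDown h0 (hz p.left_top_mul_primaryIdem) hs0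
      (hz p.top_mul_primaryIdem)).exists_algHom
    have hgf : g.comp f = q := by
      refine cubeT_algHom_ext (fun i => ?_) fun i => ?_
      · cases i with
        | zero => rw [AlgHom.comp_apply, hf, h0]; exact map_zero g
        | succ i => rw [AlgHom.comp_apply, hf]; exact hg i
      · cases i with
        | zero => rw [AlgHom.comp_apply, hfs, hs0]; exact map_zero g
        | succ i => rw [AlgHom.comp_apply, hfs]; exact hgs i
    intro a b hab
    rw [← hq, ← hgf, AlgHom.comp_apply, AlgHom.comp_apply, hab]

end Reduction

end

theorem mainTheorem4 (d : ℕ) (hd : 2 ≤ d) :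
    -- the element `u_0` is well defined, central and idempotent
    cubeU d = cubeUDual d ∧
    cubeU d ∈ Subalgebra.center ℂ (CubeT d) ∧
    IsIdempotentElem (cubeU d) ∧
    -- an isomorphism of algebras from `𝒯_d (1 - u_0)`, with identity `1 - u_0`, to `𝒯_{d-2}`
    ∃ φ : mulRightSubalgebra (1 - cubeU d) →ₙₐ[ℂ] CubeT (d - 2),
      Function.Bijective φ ∧
      φ (toMulRight (1 - cubeU d) 1) = 1 ∧
      φ (toMulRight (1 - cubeU d) (cubeE d 0)) = 0 ∧
      φ (toMulRight (1 - cubeU d) (cubeEs d 0)) = 0 ∧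
      (∀ i, 1 ≤ i → i ≤ d - 1 →
        φ (toMulRight (1 - cubeU d) (cubeE d i)) = cubeE (d - 2) (i - 1) ∧
        φ (toMulRight (1 - cubeU d) (cubeEs d i)) = cubeEs (d - 2) (i - 1)) ∧
      φ (toMulRight (1 - cubeU d) (cubeE d d)) = 0 ∧
      φ (toMulRight (1 - cubeU d) (cubeEs d d)) = 0 := by
  obtain ⟨n, rfl⟩ := Nat.exists_eq_add_of_le' hd
  have p := isCubePair_cubeT (n + 2)
  have hi : IsIdempotentElem (cubeU (n + 2)) := cubeU_eq (n + 2) ▸ p.isIdempotentElem_primaryIdem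
  refine ⟨by rw [cubeU_eq, cubeUDual_eq, p.primaryIdem_dual], cubeU_mem_center _, hi, ?_⟩
  obtain ⟨f, hf, hfs, hsurj, hu, hker⟩ := exists_reduction n
  have hw : f (1 - cubeU (n + 2)) = 1 := by rw [map_sub, map_one, hu, sub_zero]
  have hmul (a : CubeT (n + 2)) : f (a * (1 - cubeU (n + 2))) = f a := by
    rw [map_mul, hw, mul_one]
  refine ⟨(f : CubeT (n + 2) →ₙₐ[ℂ] CubeT n).comp
    (NonUnitalSubalgebraClass.subtype (mulRightSubalgebra (1 - cubeU (n + 2)))),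
    ⟨?_, fun t => ?_⟩, (hmul 1).trans (map_one f), (hmul _).trans (hf 0), (hmul _).trans (hfs 0),
    fun i h1 h2 => ?_, (hmul _).trans ((hf _).trans ?_), (hmul _).trans ((hfs _).trans ?_)⟩
  · rintro ⟨_, a, rfl⟩ ⟨_, b, rfl⟩ hab
    exact Subtype.ext (hker a b ((hmul a).symm.trans (Eq.trans hab (hmul b))))
  · obtain ⟨a, rfl⟩ := hsurj t
    exact ⟨toMulRight _ a, hmul a⟩
  · obtain ⟨j, rfl⟩ := Nat.exists_eq_add_of_le' h1
    exact ⟨(hmul _).trans (hf _), (hmul _).trans (hfs _)⟩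
  -- Index `n + 2` shifts to `n + 1`, which lies beyond the diameter `n`, where idempotents are
  -- zero.
  · exact (isCubePair_cubeT n).left.eq_zero (Nat.lt_succ_self n)
  · exact (isCubePair_cubeT n).right.eq_zero (Nat.lt_succ_self n)
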